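/- Let $\Omega\subset\mathbb{R}^n$, $n\ge 3$, be a bounded open set with $C^\infty$ boundary, and let $\gamma_0\in C^\infty(\overline\Omega)$ be real valued and strictly positive on $\overline\Omega$. Here $C^\infty(\overline\Omega)$ denotes the set of restrictions to $\overline\Omega$ of $C^\infty$ functions on $\mathbb{R}^n$. Let $m\ge 1$ be an integer and let $T=(T^{j_1\dots j_m})_{1\le j_1,\dots,j_m\le n}$ be a continuous function on $\overline\Omega$ with values in the space of symmetric tensors of rank $m$ with complex components. Let $\pi(m+1)$ denote the set of all permutations $(l_1,\dots,l_{m+1})$ of $\{1,\dots,m+1\}$, and write $v\cdot w=\sum_{j=1}^n v_jw_j$ for $v,w\in\mathbb{C}^n$. Suppose that $$\sum_{(l_1,\dots,l_{m+1})\in\pi(m+1)}\ \sum_{j_1,\dots,j_m=1}^n\int_\Omega T^{j_1\dots j_m}(x)\,\partial_{x_{j_1}}u_{l_1}\cdots\partial_{x_{j_m}}u_{l_m}\,\nabla u_{l_{m+1}}\cdot\nabla u_{m+2}\,dx=0$$ for all complex valued $u_1,\dots,u_{m+2}\in C^\infty(\overline\Omega)$ solving $\nabla\cdot(\gamma_0\nabla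 u_l)=0$ in $\Omega$, $l=1,\dots,m+2$. Then $T$ vanishes identically on $\Omega$. -/

import Mathlib

open scoped ContDiff

noncomputable section

namespace QuasilinearCalderon

/-- `Ω` has `C^∞` boundary: near each boundary point, `Ω` is the sublevel set `{ρ < 0}` of a smooth
function `ρ` whose differential does not vanish at that point. -/
def HasSmoothBoundary {n : ℕ} (Ω : Set (EuclideanSpace ℝ (Fin n))) : Prop :=
  ∀ p ∈ frontier Ω, ∃ U ∈ nhds p, ∃ ρ : EuclideanSpace ℝ (Fin n) → ℝ,
    ContDiff ℝ ∞ ρ ∧ fderiv ℝ ρ p ≠ 0 ∧ ∀ x ∈ U, (x ∈ Ω ↔ ρ x < 0)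

/-- `f ∈ C^∞(Ω̄)`: on `Ω̄` the function `f` is the restriction of a smooth function on `ℝⁿ`.
The values of `f` outside `Ω̄` play no role. -/
def SmoothOnClosure {n : ℕ} {F : Type*} [NormedAddCommGroup F] [NormedSpace ℝ F]
    (Ω : Set (EuclideanSpace ℝ (Fin n))) (f : EuclideanSpace ℝ (Fin n) → F) : Prop :=
  ∃ g : EuclideanSpace ℝ (Fin n) → F, ContDiff ℝ ∞ g ∧ Set.EqOn f g (closure Ω)

/-- The partial derivative `∂_{x_i} u` of a complex valued function on `ℝⁿ`. -/
def partialD {n : ℕ} (i : Fin n) (u : EuclideanSpace ℝ (Fin n) → ℂ)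
    (x : EuclideanSpace ℝ (Fin n)) : ℂ :=
  fderiv ℝ u x (EuclideanSpace.single i 1)

/-- The bilinear product `∇v · ∇w = ∑ i, ∂_{x_i} v ∂_{x_i} w` (no complex conjugation). -/
def gradDot {n : ℕ} (v w : EuclideanSpace ℝ (Fin n) → ℂ) (x : EuclideanSpace ℝ (Fin n)) : ℂ :=
  ∑ i : Fin n, partialD i v x * partialD i w x

/-- `u ∈ C^∞(Ω̄)` is a complex valued solution of `∇ · (γ₀ ∇u) = 0` in `Ω`. -/
def IsSmoothSolution {n : ℕ} (Ω : Set (EuclideanSpace ℝ (Fin n)))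
    (γ₀ : EuclideanSpace ℝ (Fin n) → ℝ) (u : EuclideanSpace ℝ (Fin n) → ℂ) : Prop :=
  SmoothOnClosure Ω u ∧
    ∀ x ∈ Ω, ∑ i : Fin n, partialD i (fun y => (γ₀ y : ℂ) * partialD i u y) x = 0

/-- A tensor of rank `m` on an `n`-dimensional space, given by its components `T^{j₁ … j_m}`, is
symmetric: the components are invariant under all permutations of the indices. -/
def IsSymmTensor {n m : ℕ} (T : (Fin m → Fin n) → ℂ) : Prop :=
  ∀ (σ : Equiv.Perm (Fin m)) (j : Fin m → Fin n), T (j ∘ σ) = T j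

end QuasilinearCalderon

end

/-! The proof tests the identity on complex geometric optics solutions and reads off its leading
order. Write `γ₀ = β ^ 2` on the closure of `Ω`, with `β` smooth and nowhere zero
(`exists_smooth_sqrt`). If `v` solves `Δ v = (Δ β / β) v`, then `β⁻¹ v` solves the conductivity
equation (`isSmoothSolution_of_schrodinger`). For null `ζ`, that is `ζ · ζ = 0`, with `ζ · η = 0`
and large imaginary part, `exists_cgo` produces `v = exp (i ζ · x) (exp (i η · x) + r)` with `r`
small in `C¹`. The remainder is a Fourier series over a lattice shifted by half a step along `Im ζ`.
The shift makes the symbol of the conjugated Laplacian at least a constant times `|Im ζ|`, so the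
potential is a contractive perturbation.

Use solutions with exponents `(N + 1) z_l`, where the `z_l` are null and sum to zero. The
exponentials cancel; dividing by `(N + 1) ^ (m + 2)` and letting `N → ∞` leaves an integral of
constant contractions of `T`, times `β⁻¹ ^ (m + 2)` and `exp (i ∑ η_l · x)`. If some `z_l₁ · z_l₂ ≠
0`, then `∑ η_l` can be any real frequency, and Fourier inversion gives a pointwise algebraic
identity for `T x` (`sum_contr_mul_bdot_eq_zero`).

For `m ≥ 2`, distribute two non-orthogonal null directions `ζ`, `θ` among the solutions. Since `θ ·
θ = 0`, all surviving permutations give the same term, so contractions of `T x` with both `ζ` and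
`θ` present vanish (`contr_mixed_eq_zero`). A third orthonormal vector lets one slot of a pure power
of `e₁ + i e₂` be rewritten through other null vectors, so pure powers vanish too. Expanding `2 e₁ =
(e₁ + i e₂) + (e₁ - i e₂)` and polarizing gives `T x = 0`.

For `m = 1` three null vectors summing to zero are mutually orthogonal, so the leading order carries
no information. Instead only two solutions, in directions `z` and `-z`, are sent to infinity, the
third, `u₁`, being kept: this yields `∫ (T · z) (z · ∇u₁) β⁻² exp (i η · x) = 0` for `z · η = 0`
(`integral_contr_mul_dirD_eq_zero`). Next `u₁` runs through exponentials with `ζ → ∞` null and `z ·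
ζ` fixed, giving `∫ (T · z) β⁻² z · ∇(β⁻¹ exp (i ξ · x)) = 0` (`integral_contr_mul_dirD_inv`). By
linearity `exp (i ξ · x)` may be replaced by `β exp (i ξ · x)` (`integral_mul_expo_eq_zero`), which
shows that the Fourier transform of `(T · z) β⁻²`, extended by zero, vanishes where `z · ξ ≠ 0`,
hence everywhere. -/

noncomputable section

namespace QuasilinearCalderon

open MeasureTheory Filter Topology

/-! ### Weights on `ℤⁿ` and rapidly decreasing sequences -/

/-- The weight `1 + |k|` on `ℤⁿ`. -/
def wt {n : ℕ} (k : Fin n → ℤ) : ℝ := 1 + ‖k‖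

lemma one_le_wt {n : ℕ} (k : Fin n → ℤ) : 1 ≤ wt k := by
  simp [wt]

lemma wt_pos {n : ℕ} (k : Fin n → ℤ) : 0 < wt k := zero_lt_one.trans_le (one_le_wt k)

/-- Submultiplicativity of the weight is what lets weighted norms pass through convolutions. -/
lemma wt_le_mul {n : ℕ} (k j : Fin n → ℤ) : wt k ≤ wt (k - j) * wt j := by
  have h : ‖k‖ ≤ ‖k - j‖ + ‖j‖ := by simpa using norm_add_le (k - j) j
  unfold wt
  nlinarith [norm_nonneg (k - j), norm_nonneg j]

lemma summable_prod_int {n : ℕ} {g : ℤ → ℝ} (hg0 : ∀ k, 0 ≤ g k) (hg : Summable g) :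
    Summable fun k : Fin n → ℤ => ∏ i, g (k i) := by
  induction n with
  | zero => exact (hasSum_fintype _).summable
  | succ n ih =>
    rw [← (Fin.consEquiv fun _ : Fin (n + 1) => ℤ).summable_iff]
    have := hg.mul_of_nonneg ih hg0 (fun k => Finset.prod_nonneg fun i _ => hg0 _)
    refine this.congr fun p => ?_
    simp [Fin.prod_univ_succ, Fin.consEquiv]

/-- Each `1 + |k i|` is at most `wt k`, so the exponent `2 * n` allows comparison with a product of
`n` convergent series `∑ (1 + |k|)⁻²`. -/
lemma summable_wt {n : ℕ} : Summable fun k : Fin n → ℤ => ((wt k) ^ (2 * n))⁻¹ := by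
  have h1 : Summable fun k : ℤ => ((1 + |(k : ℝ)|) ^ 2)⁻¹ := by
    have h2 : Summable fun k : ℕ => ((1 + |((k : ℤ) : ℝ)|) ^ 2)⁻¹ := by
      have := (summable_nat_add_iff 1).2 (Real.summable_nat_pow_inv.2 (one_lt_two))
      refine this.congr fun k => ?_
      simp [add_comm]
    refine Summable.of_nat_of_neg h2 ?_
    simpa using h2
  refine Summable.of_nonneg_of_le (fun k => by have := wt_pos k; positivity) (fun k => ?_)
    (summable_prod_int (n := n) (fun k => by positivity) h1)
  rw [Finset.prod_inv_distrib, pow_mul]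
  refine inv_anti₀ (Finset.prod_pos fun i _ => by positivity) ?_
  calc ∏ i, (1 + |((k i : ℤ) : ℝ)|) ^ 2 ≤ ∏ _i : Fin n, (wt k) ^ 2 := by
        refine Finset.prod_le_prod (fun i _ => by positivity) fun i _ => ?_
        have : |((k i : ℤ) : ℝ)| ≤ ‖k‖ := by
          simpa [Int.norm_eq_abs] using norm_le_pi_norm k i
        unfold wt
        gcongr
    _ = _ := by simp

/-- A family indexed by `ℤⁿ` decaying faster than any power. -/
def RapidDecay {n : ℕ} (c : (Fin n → ℤ) → ℂ) : Prop :=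
  ∀ N : ℕ, ∃ C, ∀ k, wt k ^ N * ‖c k‖ ≤ C

lemma summable_of_wt_bound {n N : ℕ} {c : (Fin n → ℤ) → ℂ} {C : ℝ}
    (h : ∀ k, wt k ^ (N + 2 * n) * ‖c k‖ ≤ C) : Summable fun k => wt k ^ N * ‖c k‖ := by
  refine Summable.of_nonneg_of_le (fun k => by have := wt_pos k; positivity) (fun k => ?_)
    ((summable_wt (n := n)).mul_left C)
  have hp := pow_pos (wt_pos k) (2 * n)
  rw [← div_eq_mul_inv, le_div_iff₀ hp]
  calc _ = wt k ^ (N + 2 * n) * ‖c k‖ := by rw [pow_add]; ring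
    _ ≤ C := h k

lemma RapidDecay.summable {n : ℕ} {c : (Fin n → ℤ) → ℂ} (h : RapidDecay c) (N : ℕ) :
    Summable fun k => wt k ^ N * ‖c k‖ := by
  obtain ⟨C, hC⟩ := h (N + 2 * n)
  exact summable_of_wt_bound hC

lemma RapidDecay.summable_norm {n : ℕ} {c : (Fin n → ℤ) → ℂ} (h : RapidDecay c) :
    Summable fun k => ‖c k‖ := by
  simpa using h.summable 0

/-! ### Fourier series of compactly supported functions -/

open UnitAddTorus FourierTransform

/-- The continuous function on the torus obtained from a function supported in a small cube. -/
lemma exists_torus_lift {n : ℕ} {g : EuclideanSpace ℝ (Fin n) → ℂ} (hg : Continuous g)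
    (hs : ∀ y, (∃ i, 1 / 4 < |y i|) → g y = 0) :
    ∃ G : C(UnitAddTorus (Fin n), ℂ),
      ∀ y : Fin n → ℝ, (∀ i, y i ∈ Set.Ioc (-(1 / 2) : ℝ) (-(1 / 2) + 1)) →
        G (fun i => (y i : UnitAddCircle)) = g (WithLp.toLp 2 y) := by
  let R : UnitAddCircle → ℝ := fun t => (AddCircle.equivIoc (1 : ℝ) (-(1 / 2)) t : ℝ)
  have hR : ∀ t, ((R t : ℝ) : UnitAddCircle) = t := fun t =>
    (AddCircle.equivIoc (1 : ℝ) (-(1 / 2))).symm_apply_apply t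
  have hRn : ∀ t, ‖t‖ ≤ |R t| := fun t => by
    conv_lhs => rw [← hR t]
    refine ((AddCircle.norm_coe_eq_abs_iff (p := (1 : ℝ)) one_ne_zero).2 ?_).le
    have := (AddCircle.equivIoc (1 : ℝ) (-(1 / 2)) t).2
    rw [abs_one, abs_le]
    constructor <;> linarith [this.1, this.2]
  refine ⟨⟨fun t => g (WithLp.toLp 2 fun i => R (t i)), ?_⟩, ?_⟩
  · rw [continuous_iff_continuousAt]
    intro t
    -- The section `R` jumps only at the seam `-1/2`. Near the seam the lifted function vanishes
    -- identically, because the support lies in the cube of half-side `1/4`.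
    by_cases h : ∃ i, t i = ((-(1 / 2) : ℝ) : UnitAddCircle)
    · obtain ⟨i, hi⟩ := h
      have hn : 1 / 4 < ‖t i‖ := by
        rw [hi]
        have := AddCircle.norm_coe_eq_abs_iff (p := (1 : ℝ)) (x := -(1 / 2)) one_ne_zero
        rw [this.2 (by norm_num [abs_of_nonneg])]
        norm_num [abs_of_nonneg]
      have hev : ∀ᶠ s in 𝓝 t, 1 / 4 < ‖s i‖ :=
        (((continuous_apply i).norm).tendsto t).eventually_const_lt hn
      refine (continuousAt_const (y := (0 : ℂ))).congr ?_
      filter_upwards [hev] with s hs'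
      exact (hs _ ⟨i, hs'.trans_le (hRn _)⟩).symm
    · push Not at h
      refine hg.continuousAt.comp ?_
      refine (PiLp.continuous_toLp 2 _).continuousAt.comp ?_
      refine continuousAt_pi.2 fun i => ?_
      refine ContinuousAt.comp (f := fun s : UnitAddTorus (Fin n) => s i) (g := R) ?_
        (continuous_apply i).continuousAt
      exact continuous_subtype_val.continuousAt.comp (AddCircle.continuousAt_equivIoc 1 (-(1/2)) (h i))
  · intro y hy
    simp only [ContinuousMap.coe_mk]
    congr 2
    funext i
    exact congrArg Subtype.val (AddCircle.equivIoc_coe_eq (hy i))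

lemma mFourier_coe {n : ℕ} (k : Fin n → ℤ) (y : Fin n → ℝ) :
    mFourier k (fun i => (y i : UnitAddCircle))
      = Complex.exp (2 * Real.pi * Complex.I * ∑ i, (k i : ℂ) * (y i : ℂ)) := by
  simp only [mFourier, ContinuousMap.coe_mk, fourier_coe_apply]
  rw [← Complex.exp_sum, Finset.mul_sum]
  congr 1
  refine Finset.sum_congr rfl fun i _ => ?_
  push_cast
  ring

/-- A smooth function supported in the cube `[-1/4, 1/4]ⁿ` is the sum of its Fourier series there,
with rapidly decreasing coefficients. -/
lemma exists_unit_fourier_series {n : ℕ} {g : EuclideanSpace ℝ (Fin n) → ℂ} (hg : ContDiff ℝ ∞ g)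
    (hs : ∀ y, 1 / 4 < ‖y‖ → g y = 0) :
    ∃ c : (Fin n → ℤ) → ℂ, RapidDecay c ∧ ∀ y, ‖y‖ ≤ 1 / 4 →
      HasSum (fun k => c k * Complex.exp (2 * Real.pi * Complex.I * ∑ i, (k i : ℂ) * (y i : ℂ)))
        (g y) := by
  have hcs : HasCompactSupport g := by
    refine HasCompactSupport.intro (isCompact_closedBall (0 : EuclideanSpace ℝ (Fin n)) (1 / 4))
      fun y hy => hs y ?_
    simpa using hy
  have habs : ∀ (y : EuclideanSpace ℝ (Fin n)) i, |y i| ≤ ‖y‖ := fun y i => by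
    simpa using PiLp.norm_apply_le y i
  obtain ⟨G, hG⟩ := exists_torus_lift hg.continuous
    (fun y ⟨i, hi⟩ => hs y (hi.trans_le (habs y i)))
  let φ : SchwartzMap (EuclideanSpace ℝ (Fin n)) ℂ := hcs.toSchwartzMap hg
  let K : (Fin n → ℤ) → EuclideanSpace ℝ (Fin n) := fun k => WithLp.toLp 2 fun i => (k i : ℝ)
  -- The Fourier coefficients are samples of the Fourier transform of a Schwartz function at integer
  -- points; rapid decay follows.
  have hcoeff : ∀ k, mFourierCoeff G k = (𝓕 φ) (K k) := by
    intro k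
    rw [mFourierCoeff_eq_integral G k (fun _ => -(1 / 2)), SchwartzMap.fourier_coe,
      Real.fourier_eq', ← (PiLp.volume_preserving_toLp (Fin n)).integral_comp
        (MeasurableEquiv.toLp 2 (Fin n → ℝ)).measurableEmbedding,
      ← integral_indicator (MeasurableSet.univ_pi' fun i => measurableSet_Ioc)]
    congr 1
    funext y
    by_cases hy : y ∈ {x : Fin n → ℝ | ∀ i, x i ∈ Set.Ioc (-(1 / 2) : ℝ) (-(1 / 2) + 1)}
    · rw [Set.indicator_of_mem hy, hG y hy, mFourier_coe]
      congr 2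
      simp only [K, PiLp.inner_apply]
      simp [Finset.mul_sum, Finset.sum_mul]
      refine Finset.sum_congr rfl fun i _ => by ring
    · rw [Set.indicator_of_notMem hy]
      have : g (WithLp.toLp 2 y) = 0 := by
        simp only [Set.mem_ofPred_eq, not_forall] at hy
        obtain ⟨i, hi⟩ := hy
        refine hs _ (lt_of_lt_of_le ?_ (habs _ i))
        simp only [Set.mem_Ioc, not_and_or, not_lt, not_le] at hi
        rw [lt_abs]
        rcases hi with hi | hi
        · right; simp only; linarith
        · left; simp only; linarith
      change 0 = _ • g (WithLp.toLp 2 y)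
      rw [this, smul_zero]
  have hdec : RapidDecay (mFourierCoeff G) := by
    intro N
    obtain ⟨C, hC⟩ : ∃ C, ∀ x, (1 + ‖x‖) ^ N * ‖(𝓕 φ) x‖ ≤ C := by
      refine ⟨2 ^ N * (Finset.Iic (N, 0)).sup (fun m => SchwartzMap.seminorm ℝ m.1 m.2) (𝓕 φ),
        fun x => ?_⟩
      simpa using SchwartzMap.one_add_le_sup_seminorm_apply (𝕜 := ℝ) (m := (N, 0)) (k := N) (n := 0)
        le_rfl le_rfl (𝓕 φ) x
    refine ⟨C, fun k => le_trans ?_ (hC (K k))⟩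
    rw [hcoeff]
    have hk : ‖k‖ ≤ ‖K k‖ := by
      refine (pi_norm_le_iff_of_nonneg (norm_nonneg _)).2 fun i => ?_
      simpa [K, Int.norm_eq_abs] using habs (K k) i
    have := wt_pos k
    unfold wt at this ⊢
    gcongr
  refine ⟨mFourierCoeff G, hdec, fun y hy => ?_⟩
  have h1 := hasSum_mFourier_series_apply_of_summable (f := G) hdec.summable_norm.of_norm
    (fun i => (y i : UnitAddCircle))
  have hb : ∀ i, y i ∈ Set.Ioc (-(1 / 2) : ℝ) (-(1 / 2) + 1) := fun i => by
    have := abs_le.1 ((habs y i).trans hy)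
    constructor <;> linarith [this.1, this.2]
  rw [hG _ hb] at h1
  simpa only [mFourier_coe, smul_eq_mul] using h1

/-! ### Complex exponentials and lattice frequencies -/

/-- The bilinear product `ζ · x`, as a real-linear map in `x`. -/
def dotL {n : ℕ} (ζ : Fin n → ℂ) : EuclideanSpace ℝ (Fin n) →L[ℝ] ℂ :=
  ∑ j, (EuclideanSpace.proj j : EuclideanSpace ℝ (Fin n) →L[ℝ] ℝ).smulRight (ζ j)

lemma dotL_apply {n : ℕ} (ζ : Fin n → ℂ) (x : EuclideanSpace ℝ (Fin n)) :
    dotL ζ x = ∑ j, ζ j * (x j : ℂ) := by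
  simp [dotL, mul_comm]

/-- The complex exponential `exp (i ζ · x)`. -/
def expo {n : ℕ} (ζ : Fin n → ℂ) (x : EuclideanSpace ℝ (Fin n)) : ℂ :=
  Complex.exp (Complex.I * dotL ζ x)

/-- A real vector, viewed as a complex one. -/
def cvec {n : ℕ} (v : EuclideanSpace ℝ (Fin n)) : Fin n → ℂ := fun j => (v j : ℂ)

@[simp] lemma cvec_apply {n : ℕ} (v : EuclideanSpace ℝ (Fin n)) (j : Fin n) :
    cvec v j = (v j : ℂ) := rfl

lemma expo_add {n : ℕ} (ζ η : Fin n → ℂ) (x : EuclideanSpace ℝ (Fin n)) :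
    expo (ζ + η) x = expo ζ x * expo η x := by
  simp only [expo, ← Complex.exp_add, dotL_apply, Pi.add_apply, add_mul, Finset.sum_add_distrib,
    mul_add]

@[simp] lemma expo_zero {n : ℕ} (x : EuclideanSpace ℝ (Fin n)) : expo 0 x = 1 := by
  simp [expo, dotL_apply]

lemma contDiff_expo {n : ℕ} (ζ : Fin n → ℂ) : ContDiff ℝ ∞ (expo ζ) :=
  (contDiff_const.mul (dotL ζ).contDiff).cexp

lemma dotL_cvec {n : ℕ} (v x : EuclideanSpace ℝ (Fin n)) : dotL (cvec v) x = (inner ℝ v x : ℝ) := by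
  rw [dotL_apply, PiLp.inner_apply]
  simp [mul_comm]

lemma norm_expo_cvec {n : ℕ} (v x : EuclideanSpace ℝ (Fin n)) : ‖expo (cvec v) x‖ = 1 := by
  rw [expo, dotL_cvec, mul_comm, Complex.norm_exp_ofReal_mul_I]

/-- The frequency `(2π/L) ∑ kᵢ bᵢ` of the dual lattice. -/
def lat {n : ℕ} (L : ℝ) (b : OrthonormalBasis (Fin n) ℝ (EuclideanSpace ℝ (Fin n)))
    (k : Fin n → ℤ) : EuclideanSpace ℝ (Fin n) :=
  (2 * Real.pi / L) • ∑ i, (k i : ℝ) • b i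

lemma lat_add {n : ℕ} (L : ℝ) (b : OrthonormalBasis (Fin n) ℝ (EuclideanSpace ℝ (Fin n)))
    (k l : Fin n → ℤ) : lat L b (k + l) = lat L b k + lat L b l := by
  simp [lat, add_smul, Finset.sum_add_distrib]

lemma cvec_add {n : ℕ} (v w : EuclideanSpace ℝ (Fin n)) : cvec (v + w) = cvec v + cvec w := by
  ext j; simp

lemma inner_lat {n : ℕ} (L : ℝ) (b : OrthonormalBasis (Fin n) ℝ (EuclideanSpace ℝ (Fin n)))
    (k : Fin n → ℤ) (x : EuclideanSpace ℝ (Fin n)) :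
    inner ℝ (lat L b k) x = 2 * Real.pi / L * ∑ i, (k i : ℝ) * inner ℝ (b i) x := by
  simp [lat, inner_smul_left, sum_inner]

/-- A smooth function supported in a ball of radius `L/4` is the sum there of a Fourier series
with rapidly decreasing coefficients, for the lattice of period `L` spanned by any orthonormal
basis. -/
lemma exists_fourier_series {n : ℕ} {L : ℝ} (hL : 0 < L)
    (b : OrthonormalBasis (Fin n) ℝ (EuclideanSpace ℝ (Fin n)))
    {f : EuclideanSpace ℝ (Fin n) → ℂ} (hf : ContDiff ℝ ∞ f)
    (hs : ∀ y, L / 4 < ‖y‖ → f y = 0) :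
    ∃ c : (Fin n → ℤ) → ℂ, RapidDecay c ∧ ∀ x, ‖x‖ ≤ L / 4 →
      HasSum (fun k => c k * expo (cvec (lat L b k)) x) (f x) := by
  obtain ⟨c, hc, h⟩ := exists_unit_fourier_series (g := fun y => f (L • b.repr.symm y))
    (hf.comp (b.repr.symm.contDiff.const_smul L)) (fun y hy => hs _ (by
      rw [norm_smul, LinearIsometryEquiv.norm_map, Real.norm_of_nonneg hL.le]
      nlinarith))
  refine ⟨c, hc, fun x hx => ?_⟩
  have := h (L⁻¹ • b.repr x) (by
    rw [norm_smul, LinearIsometryEquiv.norm_map, Real.norm_of_nonneg (inv_nonneg.2 hL.le),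
      inv_mul_le_iff₀ hL]
    linarith)
  rw [map_smul, LinearIsometryEquiv.symm_apply_apply, smul_inv_smul₀ hL.ne'] at this
  convert this using 3 with k
  rw [expo, dotL_cvec, inner_lat]
  congr 1
  have hr : ∀ i, (L⁻¹ • b.repr x) i = L⁻¹ * inner ℝ (b i) x := fun i => by
    simp [b.repr_apply_apply]
  simp only [hr]
  push_cast
  rw [Finset.mul_sum, Finset.mul_sum, Finset.mul_sum]
  refine Finset.sum_congr rfl fun i _ => ?_
  ring

/-! ### Discrete convolutions and a weighted fixed point argument -/

/-- Discrete convolution on `ℤⁿ`. -/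
def conv {n : ℕ} (q c : (Fin n → ℤ) → ℂ) (k : Fin n → ℤ) : ℂ := ∑' j, q (k - j) * c j

lemma wt_pow_mul_norm_conv_term_le {n N : ℕ} {q c : (Fin n → ℤ) → ℂ} {M : ℝ}
    (hM : ∀ k, wt k ^ N * ‖c k‖ ≤ M) (k j : Fin n → ℤ) :
    wt k ^ N * ‖q (k - j) * c j‖ ≤ wt (k - j) ^ N * ‖q (k - j)‖ * M := by
  have h1 : wt k ^ N ≤ wt (k - j) ^ N * wt j ^ N := by
    rw [← mul_pow]
    exact pow_le_pow_left₀ (wt_pos k).le (wt_le_mul k j) N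
  calc wt k ^ N * ‖q (k - j) * c j‖
      ≤ (wt (k - j) ^ N * wt j ^ N) * ‖q (k - j) * c j‖ := by gcongr
    _ = wt (k - j) ^ N * ‖q (k - j)‖ * (wt j ^ N * ‖c j‖) := by rw [norm_mul]; ring
    _ ≤ _ := by
      have := wt_pos (k - j)
      gcongr
      exact hM j

lemma hasSum_shift {n N : ℕ} {q : (Fin n → ℤ) → ℂ} (hq : RapidDecay q) (k : Fin n → ℤ) :
    HasSum (fun j => wt (k - j) ^ N * ‖q (k - j)‖) (∑' j, wt j ^ N * ‖q j‖) :=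
  (Equiv.subLeft k).hasSum_iff.2 (hq.summable N).hasSum

lemma summable_conv {n : ℕ} {q c : (Fin n → ℤ) → ℂ} (hq : RapidDecay q) {M : ℝ}
    (hM : ∀ k, ‖c k‖ ≤ M) (k : Fin n → ℤ) : Summable fun j => q (k - j) * c j := by
  refine Summable.of_norm_bounded (((hasSum_shift (N := 0) hq k).summable).mul_right M)
    fun j => ?_
  simpa using wt_pow_mul_norm_conv_term_le (N := 0) (q := q) (by simpa using hM) k j

/-- Young's inequality `ℓ¹ * ℓ^∞ ⊆ ℓ^∞` in weighted form. -/
lemma wt_pow_mul_norm_conv_le {n N : ℕ} {q c : (Fin n → ℤ) → ℂ} (hq : RapidDecay q) {M : ℝ}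
    (hM : ∀ k, wt k ^ N * ‖c k‖ ≤ M) (k : Fin n → ℤ) :
    wt k ^ N * ‖conv q c k‖ ≤ (∑' j, wt j ^ N * ‖q j‖) * M := by
  have hw : 0 < wt k ^ N := pow_pos (wt_pos k) N
  have h1 := (hasSum_shift (N := N) hq k).mul_right M
  have : ‖conv q c k‖ ≤ ((wt k ^ N)⁻¹ * ((∑' j, wt j ^ N * ‖q j‖) * M)) := by
    refine tsum_of_norm_bounded (h1.mul_left (wt k ^ N)⁻¹) fun j => ?_
    rw [le_inv_mul_iff₀ hw]
    exact wt_pow_mul_norm_conv_term_le hM k j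
  rwa [le_inv_mul_iff₀ hw] at this

lemma norm_le_of_wt_pow_le {n N : ℕ} {c : (Fin n → ℤ) → ℂ} {M : ℝ}
    (hM : ∀ k, wt k ^ N * ‖c k‖ ≤ M) (k : Fin n → ℤ) : ‖c k‖ ≤ M :=
  le_trans (le_mul_of_one_le_left (norm_nonneg _) (one_le_pow₀ (one_le_wt k))) (hM k)

/-- Bootstrap: solving the equation for `c k` and dividing by `σ k` gains one power of the weight,
starting from mere boundedness. -/
lemma rapidDecay_of_eq {n : ℕ} {q f c σ : (Fin n → ℤ) → ℂ} (hq : RapidDecay q)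
    (hf : RapidDecay f) {δ : ℝ} (hδ : 0 < δ) (hσ : ∀ k, δ * wt k ≤ ‖σ k‖) {M : ℝ}
    (hM : ∀ k, ‖c k‖ ≤ M) (h : ∀ k, σ k * c k + conv q c k = f k) : RapidDecay c := by
  intro N
  induction N with
  | zero => exact ⟨M, by simpa using hM⟩
  | succ N ih =>
    obtain ⟨C, hC⟩ := ih
    obtain ⟨D, hD⟩ := hf N
    refine ⟨(D + (∑' j, wt j ^ N * ‖q j‖) * C) / δ, fun k => ?_⟩
    rw [le_div_iff₀ hδ]
    have hw := pow_pos (wt_pos k) N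
    calc wt k ^ (N + 1) * ‖c k‖ * δ = wt k ^ N * ((δ * wt k) * ‖c k‖) := by ring
      _ ≤ wt k ^ N * (‖σ k‖ * ‖c k‖) := by gcongr; exact hσ k
      _ = wt k ^ N * ‖f k - conv q c k‖ := by
        rw [← norm_mul, ← h k]; congr 2; ring
      _ ≤ wt k ^ N * (‖f k‖ + ‖conv q c k‖) := by gcongr; exact norm_sub_le _ _
      _ ≤ _ := by
        rw [mul_add]
        exact add_le_add (hD k) (wt_pow_mul_norm_conv_le hq hC k)

/-- Solvability of `σ c + q * c = f` in rapidly decreasing families, if the multiplier `σ` is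
large and grows at least linearly. -/
lemma exists_conv_solution {n : ℕ} {q f : (Fin n → ℤ) → ℂ} (hq : RapidDecay q)
    (hf : RapidDecay f) (N : ℕ) :
    ∃ C s₀ : ℝ, 0 < s₀ ∧ 0 ≤ C ∧ ∀ s ≥ s₀, ∀ σ : (Fin n → ℤ) → ℂ, (∀ k, s ≤ ‖σ k‖) →
      (∃ δ > 0, ∀ k, δ * wt k ≤ ‖σ k‖) →
      ∃ c, RapidDecay c ∧ (∀ k, σ k * c k + conv q c k = f k) ∧
        ∀ k, wt k ^ N * ‖c k‖ ≤ C / s := by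
  obtain ⟨D, hD⟩ := hf N
  have hD0 : 0 ≤ D := le_trans (by have := wt_pos (0 : Fin n → ℤ); positivity) (hD 0)
  set Q := ∑' j, wt j ^ N * ‖q j‖ with hQ
  have hQ0 : 0 ≤ Q := tsum_nonneg fun j => by have := wt_pos j; positivity
  -- The threshold `2 * Q + 1` makes `Q / s ≤ 1 / 2`, which is the contraction constant; absorbing
  -- `‖d‖ / 2` then produces the factor `2 * D`. The fixed point is sought for the weighted family
  -- `d = wt ^ N * c`. The constant `δ` only enters the qualitative decay of `c`, not the final
  -- bound.
  refine ⟨2 * D, 2 * Q + 1, by positivity, by positivity, fun s hs σ hσ ⟨δ, hδ, hσδ⟩ => ?_⟩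
  have hs0 : 0 < s := by linarith
  have hσ0 : ∀ k, σ k ≠ 0 := fun k => norm_pos_iff.1 (hs0.trans_le (hσ k))
  -- removing the weight
  let U : BoundedContinuousFunction (Fin n → ℤ) ℂ → (Fin n → ℤ) → ℂ :=
    fun d j => d j / (wt j : ℂ) ^ N
  have hU : ∀ (d : BoundedContinuousFunction (Fin n → ℤ) ℂ) k, wt k ^ N * ‖U d k‖ ≤ ‖d‖ := by
    intro d k
    have hw := wt_pos k
    have h1 : ‖U d k‖ = ‖d k‖ / wt k ^ N := by
      simp only [U, norm_div, norm_pow, Complex.norm_real, Real.norm_of_nonneg hw.le]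
    rw [h1, mul_div_cancel₀ _ (pow_pos hw N).ne']
    exact d.norm_coe_le_norm k
  let g : BoundedContinuousFunction (Fin n → ℤ) ℂ → (Fin n → ℤ) → ℂ :=
    fun d k => (wt k : ℂ) ^ N * (f k - conv q (U d) k) / σ k
  have hgen : ∀ (k : Fin n → ℤ) (z : ℂ) (B : ℝ), wt k ^ N * ‖z‖ ≤ B →
      ‖(wt k : ℂ) ^ N * z / σ k‖ ≤ B / s := by
    intro k z B hB
    have hw := wt_pos k
    rw [norm_div, norm_mul, norm_pow, Complex.norm_real, Real.norm_of_nonneg hw.le]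
    have hB0 : 0 ≤ B := le_trans (by positivity) hB
    exact div_le_div₀ hB0 hB hs0 (hσ k)
  have hgb : ∀ d k, ‖g d k‖ ≤ (D + Q * ‖d‖) / s := by
    intro d k
    refine hgen k _ _ ?_
    have hw := pow_pos (wt_pos k) N
    calc wt k ^ N * ‖f k - conv q (U d) k‖ ≤ wt k ^ N * (‖f k‖ + ‖conv q (U d) k‖) := by
          gcongr; exact norm_sub_le _ _
      _ ≤ _ := by
        rw [mul_add]
        exact add_le_add (hD k) (wt_pow_mul_norm_conv_le hq (hU d) k)
  let Φ : BoundedContinuousFunction (Fin n → ℤ) ℂ → BoundedContinuousFunction (Fin n → ℤ) ℂ :=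
    fun d => BoundedContinuousFunction.ofNormedAddCommGroupDiscrete (g d) _ (hgb d)
  have hQs : Q / s ≤ 1 / 2 := by
    rw [div_le_iff₀ hs0]; linarith
  have hcontr : ContractingWith (1 / 2) Φ := by
    refine ⟨by norm_num [← NNReal.coe_lt_coe], LipschitzWith.of_dist_le_mul fun d d' => ?_⟩
    rw [BoundedContinuousFunction.dist_le (by positivity)]
    intro k
    have hdiff : conv q (U d') k - conv q (U d) k = conv q (U (d' - d)) k := by
      unfold conv
      rw [← (summable_conv hq (norm_le_of_wt_pow_le (hU d')) k).tsum_sub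
        (summable_conv hq (norm_le_of_wt_pow_le (hU d)) k)]
      refine tsum_congr fun j => ?_
      simp only [U, BoundedContinuousFunction.coe_sub, Pi.sub_apply]
      ring
    have h1 : g d k - g d' k = (wt k : ℂ) ^ N * conv q (U (d' - d)) k / σ k := by
      rw [← hdiff]; simp only [g]; ring
    change dist (g d k) (g d' k) ≤ _
    rw [dist_eq_norm, h1]
    refine (hgen k _ _ (wt_pow_mul_norm_conv_le hq (hU (d' - d)) k)).trans ?_
    rw [dist_comm, dist_eq_norm, mul_div_right_comm]
    have : ((1 / 2 : NNReal) : ℝ) = 1 / 2 := by norm_num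
    rw [this]
    exact mul_le_mul_of_nonneg_right hQs (norm_nonneg _)
  let d := ContractingWith.fixedPoint Φ hcontr
  have hd : Φ d = d := hcontr.fixedPoint_isFixedPt
  have hdk : ∀ k, g d k = d k := fun k => congrArg (fun h => h k) hd
  have hdn : ‖d‖ ≤ 2 * D / s := by
    have h1 : ‖d‖ ≤ (D + Q * ‖d‖) / s := by
      rw [BoundedContinuousFunction.norm_le (by positivity)]
      intro k
      rw [← hdk k]
      exact hgb d k
    have h2 : (D + Q * ‖d‖) / s = D / s + Q / s * ‖d‖ := by ring
    have h3 : Q / s * ‖d‖ ≤ 1 / 2 * ‖d‖ := mul_le_mul_of_nonneg_right hQs (norm_nonneg _)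
    have h4 : 2 * D / s = 2 * (D / s) := by ring
    linarith
  have heq : ∀ k, σ k * U d k + conv q (U d) k = f k := by
    intro k
    have hw : (wt k : ℂ) ^ N ≠ 0 := pow_ne_zero _ (by exact_mod_cast (wt_pos k).ne')
    have h1 : U d k = (f k - conv q (U d) k) / σ k := by
      have : U d k = g d k / (wt k : ℂ) ^ N := by rw [hdk]
      rw [this]
      simp only [g]
      field_simp
    rw [h1, mul_div_cancel₀ _ (hσ0 k)]
    ring
  exact ⟨U d, rapidDecay_of_eq hq hf hδ hσδ (norm_le_of_wt_pow_le (hU d)) heq, heq,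
    fun k => (hU d k).trans hdn⟩

lemma conv_rapidDecay {n : ℕ} {q c : (Fin n → ℤ) → ℂ} (hq : RapidDecay q) (hc : RapidDecay c) :
    RapidDecay (conv q c) := by
  intro N
  obtain ⟨C, hC⟩ := hc N
  exact ⟨(∑' j, wt j ^ N * ‖q j‖) * C, fun k => wt_pow_mul_norm_conv_le hq hC k⟩

/-- The shear `(a, b) ↦ (a - b, b)` of an additive group. -/
def shearEquiv (G : Type*) [AddGroup G] : G × G ≃ G × G where
  toFun p := (p.1 - p.2, p.2)
  invFun p := (p.1 + p.2, p.2)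
  left_inv p := by simp
  right_inv p := by simp

/-- Cauchy product for a unimodular character `e`; it turns multiplication by the potential into
convolution of coefficients. -/
lemma tsum_mul_tsum_eq_tsum_conv {n : ℕ} {q c e : (Fin n → ℤ) → ℂ} (hq : RapidDecay q)
    (hc : RapidDecay c) (he : ∀ k, ‖e k‖ = 1) (hadd : ∀ k l, e (k + l) = e k * e l) :
    (∑' k, q k * e k) * (∑' k, c k * e k) = ∑' k, conv q c k * e k := by
  have h1 : Summable fun k => ‖q k * e k‖ := by simpa [he] using hq.summable_norm
  have h2 : Summable fun k => ‖c k * e k‖ := by simpa [he] using hc.summable_norm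
  let Ψ : (Fin n → ℤ) × (Fin n → ℤ) ≃ (Fin n → ℤ) × (Fin n → ℤ) := shearEquiv _
  let F : (Fin n → ℤ) × (Fin n → ℤ) → ℂ := fun p => (q p.1 * e p.1) * (c p.2 * e p.2)
  have h3 : Summable F :=
    summable_mul_of_summable_norm (f := fun k => q k * e k) (g := fun k => c k * e k) h1 h2
  have h4 : Summable (F ∘ Ψ) := Ψ.summable_iff.2 h3
  have h5 : ∑' p, F (Ψ p) = ∑' k, ∑' j, F (Ψ (k, j)) := h4.tsum_prod
  rw [tsum_mul_tsum_of_summable_norm (f := fun k => q k * e k) (g := fun k => c k * e k) h1 h2]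
  change ∑' p, F p = _
  rw [← Ψ.tsum_eq, h5]
  refine tsum_congr fun k => ?_
  rw [conv, ← tsum_mul_right]
  refine tsum_congr fun j => ?_
  have : e k = e (k - j) * e j := by rw [← hadd]; simp
  change q (k - j) * e (k - j) * (c j * e j) = _
  rw [this]
  ring

/-! ### Partial derivatives -/

lemma partialD_congr {n : ℕ} {i : Fin n} {u v : EuclideanSpace ℝ (Fin n) → ℂ}
    {x : EuclideanSpace ℝ (Fin n)} (h : u =ᶠ[𝓝 x] v) : partialD i u x = partialD i v x := by
  rw [partialD, h.fderiv_eq, partialD]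

lemma partialD_add {n : ℕ} {i : Fin n} {u v : EuclideanSpace ℝ (Fin n) → ℂ}
    {x : EuclideanSpace ℝ (Fin n)} (hu : DifferentiableAt ℝ u x) (hv : DifferentiableAt ℝ v x) :
    partialD i (fun y => u y + v y) x = partialD i u x + partialD i v x := by
  simp [partialD, fderiv_fun_add hu hv]

lemma partialD_sub {n : ℕ} {i : Fin n} {u v : EuclideanSpace ℝ (Fin n) → ℂ}
    {x : EuclideanSpace ℝ (Fin n)} (hu : DifferentiableAt ℝ u x) (hv : DifferentiableAt ℝ v x) :
    partialD i (fun y => u y - v y) x = partialD i u x - partialD i v x := by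
  simp [partialD, fderiv_fun_sub hu hv]

lemma partialD_mul {n : ℕ} {i : Fin n} {u v : EuclideanSpace ℝ (Fin n) → ℂ}
    {x : EuclideanSpace ℝ (Fin n)} (hu : DifferentiableAt ℝ u x) (hv : DifferentiableAt ℝ v x) :
    partialD i (fun y => u y * v y) x = partialD i u x * v x + u x * partialD i v x := by
  simp [partialD, fderiv_fun_mul hu hv]
  ring

lemma dotL_single {n : ℕ} (ζ : Fin n → ℂ) (j : Fin n) :
    dotL ζ (EuclideanSpace.single j 1) = ζ j := by
  rw [dotL_apply, Finset.sum_eq_single j] <;> simp +contextual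

lemma hasFDerivAt_expo {n : ℕ} (ζ : Fin n → ℂ) (x : EuclideanSpace ℝ (Fin n)) :
    HasFDerivAt (expo ζ) (expo ζ x • (Complex.I • dotL ζ)) x :=
  ((dotL ζ).hasFDerivAt.const_mul Complex.I).cexp

lemma differentiable_expo {n : ℕ} (ζ : Fin n → ℂ) : Differentiable ℝ (expo ζ) :=
  fun x => (hasFDerivAt_expo ζ x).differentiableAt

lemma partialD_expo {n : ℕ} (ζ : Fin n → ℂ) (j : Fin n) (x : EuclideanSpace ℝ (Fin n)) :
    partialD j (expo ζ) x = Complex.I * ζ j * expo ζ x := by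
  simp [partialD, (hasFDerivAt_expo ζ x).fderiv, dotL_single]
  ring

lemma partialD_expo_mul {n : ℕ} (ζ : Fin n → ℂ) (j : Fin n) {h : EuclideanSpace ℝ (Fin n) → ℂ}
    {x : EuclideanSpace ℝ (Fin n)} (hh : DifferentiableAt ℝ h x) :
    partialD j (fun y => expo ζ y * h y) x
      = expo ζ x * (Complex.I * ζ j * h x + partialD j h x) := by
  rw [partialD_mul (differentiable_expo ζ x) hh, partialD_expo]
  ring

lemma contDiff_partialD {n : ℕ} {u : EuclideanSpace ℝ (Fin n) → ℂ} (hu : ContDiff ℝ ∞ u)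
    (i : Fin n) : ContDiff ℝ ∞ (partialD i u) :=
  (hu.fderiv_right (m := ∞) (by simp)).clm_apply contDiff_const

/-! ### Exponential series with rapidly decreasing coefficients -/

lemma iteratedDeriv_exp_mul_I (N : ℕ) :
    iteratedDeriv N (fun t : ℝ => Complex.exp (Complex.I * t))
      = fun t : ℝ => Complex.I ^ N * Complex.exp (Complex.I * t) := by
  induction N with
  | zero => simp
  | succ N ih =>
    rw [iteratedDeriv_succ, ih]
    funext t
    have h1 : HasDerivAt (fun t : ℝ => Complex.exp (Complex.I * t))
        (Complex.exp (Complex.I * t) * (Complex.I * 1)) t :=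
      ((Complex.ofRealCLM.hasDerivAt (x := t)).const_mul Complex.I).cexp
    rw [(h1.const_mul (Complex.I ^ N)).deriv]
    ring

/-- The exponential is a function of the single real variable `⟨v, x⟩`, and each derivative in that
variable has modulus one. -/
lemma norm_iteratedFDeriv_expo_le {n : ℕ} (v x : EuclideanSpace ℝ (Fin n)) (N : ℕ) :
    ‖iteratedFDeriv ℝ N (expo (cvec v)) x‖ ≤ ‖v‖ ^ N := by
  have h0 : expo (cvec v) = (fun t : ℝ => Complex.exp (Complex.I * t)) ∘ (innerSL ℝ v) := by
    funext y
    simp [expo, dotL_cvec]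
  have hsm : ContDiff ℝ N (fun t : ℝ => Complex.exp (Complex.I * t)) :=
    (contDiff_const.mul Complex.ofRealCLM.contDiff).cexp
  rw [h0, (innerSL ℝ v).iteratedFDeriv_comp_right hsm x le_rfl]
  refine (ContinuousMultilinearMap.norm_compContinuousLinearMap_le _ _).trans ?_
  rw [norm_iteratedFDeriv_eq_norm_iteratedDeriv, iteratedDeriv_exp_mul_I]
  rw [norm_mul, norm_pow, Complex.norm_I, one_pow, one_mul, mul_comm Complex.I,
    Complex.norm_exp_ofReal_mul_I, one_mul]
  simp

/-- The series `∑ c_k exp (i μ_k · x)`. -/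
def expSeries {n : ℕ} (μ : (Fin n → ℤ) → EuclideanSpace ℝ (Fin n)) (c : (Fin n → ℤ) → ℂ)
    (x : EuclideanSpace ℝ (Fin n)) : ℂ := ∑' k, c k * expo (cvec (μ k)) x

section ExpSeries

variable {n : ℕ} {μ : (Fin n → ℤ) → EuclideanSpace ℝ (Fin n)} {c : (Fin n → ℤ) → ℂ} {M : ℝ}

lemma summable_expSeries (hc : RapidDecay c) (x : EuclideanSpace ℝ (Fin n)) :
    Summable fun k => c k * expo (cvec (μ k)) x :=
  Summable.of_norm (by simpa [norm_expo_cvec] using hc.summable_norm)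

lemma contDiff_expSeries (hM : ∀ k, ‖μ k‖ ≤ M * wt k) (hc : RapidDecay c) :
    ContDiff ℝ ∞ (expSeries μ c) := by
  have hM0 : 0 ≤ M := by
    have h := (norm_nonneg _).trans (hM 0)
    exact nonneg_of_mul_nonneg_left h (wt_pos _)
  refine contDiff_tsum (N := ⊤) (v := fun N k => M ^ N * (wt k ^ N * ‖c k‖))
    (fun k => contDiff_const.mul (contDiff_expo _)) (fun N _ => (hc.summable N).mul_left _)
    fun N k x _ => ?_
  have h1 : ‖iteratedFDeriv ℝ N (fun x => c k * expo (cvec (μ k)) x) x‖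
      = ‖c k‖ * ‖iteratedFDeriv ℝ N (expo (cvec (μ k))) x‖ := by
    rw [← norm_smul, ← iteratedFDeriv_const_smul_apply
      ((contDiff_expo _).contDiffAt.of_le (by exact_mod_cast le_top))]
    rfl
  rw [h1]
  calc ‖c k‖ * ‖iteratedFDeriv ℝ N (expo (cvec (μ k))) x‖ ≤ ‖c k‖ * (M * wt k) ^ N := by
        gcongr
        exact (norm_iteratedFDeriv_expo_le _ _ _).trans
          (pow_le_pow_left₀ (norm_nonneg _) (hM k) N)
    _ = _ := by rw [mul_pow]; ring

lemma norm_apply_le_norm (v : EuclideanSpace ℝ (Fin n)) (j : Fin n) : ‖(v j : ℂ)‖ ≤ ‖v‖ := by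
  simpa using PiLp.norm_apply_le v j

lemma rapidDecay_mul (hc : RapidDecay c) {a : (Fin n → ℤ) → ℂ} {A : ℝ} {P : ℕ}
    (ha : ∀ k, ‖a k‖ ≤ A * wt k ^ P) : RapidDecay fun k => a k * c k := by
  intro N
  obtain ⟨C, hC⟩ := hc (N + P)
  have hA : 0 ≤ A := nonneg_of_mul_nonneg_left ((norm_nonneg _).trans (ha 0))
    (pow_pos (wt_pos _) _)
  refine ⟨A * C, fun k => ?_⟩
  have hw := pow_pos (wt_pos k) N
  calc wt k ^ N * ‖a k * c k‖ = wt k ^ N * (‖a k‖ * ‖c k‖) := by rw [norm_mul]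
    _ ≤ wt k ^ N * ((A * wt k ^ P) * ‖c k‖) := by gcongr; exact ha k
    _ = A * (wt k ^ (N + P) * ‖c k‖) := by rw [pow_add]; ring
    _ ≤ A * C := by gcongr; exact hC k

lemma norm_freq_le (hM : ∀ k, ‖μ k‖ ≤ M * wt k) (z : ℂ) (j : Fin n) (k : Fin n → ℤ) :
    ‖Complex.I * ((μ k j : ℂ) + z)‖ ≤ (M + ‖z‖) * wt k ^ 1 := by
  rw [norm_mul, Complex.norm_I, one_mul, pow_one]
  refine (norm_add_le _ _).trans ?_
  have := (norm_apply_le_norm (μ k) j).trans (hM k)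
  nlinarith [one_le_wt k, norm_nonneg z]

lemma partialD_expSeries (hM : ∀ k, ‖μ k‖ ≤ M * wt k) (hc : RapidDecay c) (j : Fin n)
    (x : EuclideanSpace ℝ (Fin n)) :
    partialD j (expSeries μ c) x = expSeries μ (fun k => Complex.I * (μ k j : ℂ) * c k) x := by
  have hf : ∀ k (y : EuclideanSpace ℝ (Fin n)), HasFDerivAt
      (fun y => c k * expo (cvec (μ k)) y)
      (c k • (expo (cvec (μ k)) y • (Complex.I • dotL (cvec (μ k))))) y := fun k y =>
    (hasFDerivAt_expo _ y).const_mul (c k)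
  have hdn : ∀ v : EuclideanSpace ℝ (Fin n), ‖dotL (cvec v)‖ ≤ ‖v‖ := fun v =>
    ContinuousLinearMap.opNorm_le_bound _ (norm_nonneg _) fun y => by
      rw [dotL_cvec, Complex.norm_real]
      exact norm_inner_le_norm v y
  have hb : ∀ k (y : EuclideanSpace ℝ (Fin n)),
      ‖c k • (expo (cvec (μ k)) y • (Complex.I • dotL (cvec (μ k))))‖
        ≤ M * (wt k ^ 1 * ‖c k‖) := fun k y => by
    rw [norm_smul, norm_smul, norm_smul, norm_expo_cvec, Complex.norm_I, one_mul, one_mul, pow_one]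
    have := (hdn (μ k)).trans (hM k)
    nlinarith [norm_nonneg (c k)]
  have hsum := (hc.summable 1).mul_left M
  have h := hasFDerivAt_tsum hsum hf hb (summable_expSeries (μ := μ) hc 0) x
  have hs : Summable fun k => c k • (expo (cvec (μ k)) x • (Complex.I • dotL (cvec (μ k)))) :=
    Summable.of_norm_bounded hsum fun k => hb k x
  change fderiv ℝ (expSeries μ c) x _ = _
  have h' : fderiv ℝ (expSeries μ c) x = _ := h.fderiv
  rw [h']
  have := ((ContinuousLinearMap.apply ℝ ℂ (EuclideanSpace.single j (1 : ℝ))).map_tsum hs)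
  refine this.trans (tsum_congr fun k => ?_)
  simp [dotL_single]
  ring

/-- The class of functions `exp (i ζ · x) (a exp (i η · x) + series)` is closed under partial
derivatives, which act on `a` and on the coefficients by multiplication. Second derivatives follow
by applying this twice, which is why a general `a` is allowed. -/
lemma partialD_cgo (hM : ∀ k, ‖μ k‖ ≤ M * wt k) (hc : RapidDecay c) (ζ η : Fin n → ℂ) (a : ℂ)
    (j : Fin n) :
    partialD j (fun y => expo ζ y * (a * expo η y + expSeries μ c y))
      = fun x => expo ζ x * ((Complex.I * (η j + ζ j) * a) * expo η x
        + expSeries μ (fun k => Complex.I * ((μ k j : ℂ) + ζ j) * c k) x) := by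
  funext x
  have h1 : DifferentiableAt ℝ (expSeries μ c) x :=
    (contDiff_expSeries hM hc).differentiable (by simp) x
  have h2 : DifferentiableAt ℝ (fun y => a * expo η y) x :=
    (differentiable_expo η x).const_mul a
  have h3 : partialD j (fun y => a * expo η y) x = a * (Complex.I * η j * expo η x) := by
    rw [partialD_mul (differentiableAt_const a) (differentiable_expo η x), partialD_expo]
    simp [partialD]
  have h4 : expSeries μ (fun k => Complex.I * ((μ k j : ℂ) + ζ j) * c k) x
      = expSeries μ (fun k => Complex.I * (μ k j : ℂ) * c k) x
        + Complex.I * ζ j * expSeries μ c x := by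
    have hr := rapidDecay_mul hc (norm_freq_le hM 0 j)
    simp only [add_zero] at hr
    unfold expSeries
    rw [← tsum_mul_left, ← (summable_expSeries hr x).tsum_add
      ((summable_expSeries hc x).mul_left _)]
    exact tsum_congr fun k => by ring
  rw [partialD_expo_mul ζ j (h2.fun_add h1), partialD_add h2 h1, h3, partialD_expSeries hM hc, h4]
  ring

lemma norm_expSeries_le {B : ℝ} (hc : ∀ k, wt k ^ (2 * n) * ‖c k‖ ≤ B)
    (x : EuclideanSpace ℝ (Fin n)) :
    ‖expSeries μ c x‖ ≤ B * ∑' k : Fin n → ℤ, ((wt k) ^ (2 * n))⁻¹ := by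
  refine tsum_of_norm_bounded ((summable_wt (n := n)).hasSum.mul_left B) fun k => ?_
  rw [norm_mul, norm_expo_cvec, mul_one, ← div_eq_mul_inv, le_div_iff₀ (pow_pos (wt_pos k) _),
    mul_comm]
  exact hc k

end ExpSeries

/-! ### Complex geometric optics solutions of the Schrödinger equation -/

lemma exists_orthonormalBasis_apply_eq {n : ℕ} (i₀ : Fin n) {e : EuclideanSpace ℝ (Fin n)}
    (he : ‖e‖ = 1) :
    ∃ b : OrthonormalBasis (Fin n) ℝ (EuclideanSpace ℝ (Fin n)), b i₀ = e := by
  have hv : Orthonormal ℝ (({i₀} : Set (Fin n)).domRestrict fun _ => e) := by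
    refine ⟨fun _ => he, fun i j hij => absurd (Subsingleton.elim i j) hij⟩
  obtain ⟨b, hb⟩ := hv.exists_orthonormalBasis_extension_of_card_eq (by simp)
  exact ⟨b, hb i₀ rfl⟩

/-! ### The symbol of the conjugated Laplacian on the shifted lattice. -/

section Symbol

variable {n : ℕ} {L : ℝ} {b : OrthonormalBasis (Fin n) ℝ (EuclideanSpace ℝ (Fin n))}

lemma inner_lat_basis (k : Fin n → ℤ) (i : Fin n) :
    inner ℝ (lat L b k) (b i) = 2 * Real.pi / L * k i := by
  rw [inner_lat]
  simp [OrthonormalBasis.inner_eq_ite]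

lemma norm_lat_le (hL : 0 < L) (k : Fin n → ℤ) :
    ‖lat L b k‖ ≤ 2 * Real.pi / L * n * ‖k‖ := by
  have hp : 0 < 2 * Real.pi / L := by positivity
  rw [lat, norm_smul, Real.norm_of_nonneg hp.le, mul_assoc]
  gcongr
  refine (norm_sum_le _ _).trans ?_
  calc ∑ i, ‖(k i : ℝ) • b i‖ ≤ ∑ _i : Fin n, ‖k‖ := by
        refine Finset.sum_le_sum fun i _ => ?_
        rw [norm_smul, b.norm_eq_one, mul_one]
        simpa [Int.norm_eq_abs] using norm_le_pi_norm k i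
    _ = n * ‖k‖ := by simp

lemma norm_le_lat (hL : 0 < L) (k : Fin n → ℤ) : ‖k‖ ≤ L / (2 * Real.pi) * ‖lat L b k‖ := by
  refine (pi_norm_le_iff_of_nonneg (by positivity)).2 fun i => ?_
  have h1 : (k i : ℝ) = L / (2 * Real.pi) * inner ℝ (lat L b k) (b i) := by
    rw [inner_lat_basis]
    field_simp
  rw [Int.norm_eq_abs, h1, abs_mul, abs_of_pos (by positivity)]
  gcongr
  simpa using abs_real_inner_le_norm (lat L b k) (b i)

/-- The symbol of the conjugated Laplacian at a real frequency. -/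
def symb (ζ : Fin n → ℂ) (μ : EuclideanSpace ℝ (Fin n)) : ℂ :=
  ∑ j, ((μ j : ℂ) ^ 2 + 2 * ζ j * (μ j : ℂ))

lemma symb_im {τ : ℝ} {e : EuclideanSpace ℝ (Fin n)} {ζ : Fin n → ℂ}
    (hζ : ∀ j, (ζ j).im = τ * e j) (μ : EuclideanSpace ℝ (Fin n)) :
    (symb ζ μ).im = 2 * τ * inner ℝ μ e := by
  rw [symb, Complex.im_sum, PiLp.inner_apply, Finset.mul_sum]
  refine Finset.sum_congr rfl fun j _ => ?_
  simp [pow_two, hζ]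
  ring

/-- At high frequency the quadratic part dominates the term linear in `μ`; this bound gives the
growth needed for rapid decay. -/
lemma norm_symb_ge (ζ : Fin n → ℂ) (μ : EuclideanSpace ℝ (Fin n)) :
    ‖μ‖ ^ 2 - 2 * (∑ j, ‖ζ j‖) * ‖μ‖ ≤ ‖symb ζ μ‖ := by
  have h1 : symb ζ μ = ((‖μ‖ ^ 2 : ℝ) : ℂ) + ∑ j, 2 * ζ j * (μ j : ℂ) := by
    rw [symb, Finset.sum_add_distrib, EuclideanSpace.norm_sq_eq]
    push_cast
    simp [← Complex.ofReal_pow]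
  have h2 : ‖∑ j, 2 * ζ j * (μ j : ℂ)‖ ≤ 2 * (∑ j, ‖ζ j‖) * ‖μ‖ := by
    refine (norm_sum_le _ _).trans ?_
    rw [Finset.mul_sum, Finset.sum_mul]
    refine Finset.sum_le_sum fun j _ => ?_
    rw [norm_mul, norm_mul, Complex.norm_ofNat]
    gcongr
    exact norm_apply_le_norm μ j
  have h3 := norm_sub_le (symb ζ μ) (∑ j, 2 * ζ j * (μ j : ℂ))
  rw [h1, add_sub_cancel_right, Complex.norm_real, Real.norm_of_nonneg (sq_nonneg _), ← h1] at h3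
  linarith

/-- The half-step shift makes the component of every frequency along `b i₀` equal to `π / L` times
an odd integer. The imaginary part of the symbol, `2 τ` times this component, is therefore bounded
away from zero uniformly in `k`. -/
lemma symb_bounds (hL : 0 < L) {i₀ : Fin n} {τ : ℝ} (hτ : 0 < τ) {ζ : Fin n → ℂ}
    (hζ : ∀ j, (ζ j).im = τ * b i₀ j) :
    (∀ k, 2 * Real.pi * τ / L ≤ ‖symb ζ (lat L b k + (Real.pi / L) • b i₀)‖) ∧
      ∃ δ > 0, ∀ k, δ * wt k ≤ ‖symb ζ (lat L b k + (Real.pi / L) • b i₀)‖ := by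
  have hlow : ∀ k, 2 * Real.pi * τ / L ≤ ‖symb ζ (lat L b k + (Real.pi / L) • b i₀)‖ := by
    intro k
    refine le_trans ?_ (Complex.abs_im_le_norm _)
    rw [symb_im hζ, inner_add_left, inner_lat_basis, inner_smul_left, real_inner_self_eq_norm_sq,
      b.norm_eq_one]
    have h1 : 2 * τ * (2 * Real.pi / L * (k i₀ : ℝ) + (starRingEnd ℝ) (Real.pi / L) * 1 ^ 2)
        = 2 * Real.pi * τ / L * (2 * k i₀ + 1) := by
      simp; ring
    rw [h1, abs_mul, abs_of_pos (by positivity)]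
    have h2 : (1 : ℝ) ≤ |2 * (k i₀ : ℝ) + 1| := by
      have : (1 : ℤ) ≤ |2 * k i₀ + 1| := Int.one_le_abs (by omega)
      exact_mod_cast this
    exact le_mul_of_one_le_right (by positivity) h2
  refine ⟨hlow, ?_⟩
  set s := 2 * Real.pi * τ / L with hs
  have hs0 : 0 < s := by positivity
  set Z := ∑ j, ‖ζ j‖ with hZ
  have hZ0 : 0 ≤ Z := Finset.sum_nonneg fun j _ => norm_nonneg _
  have h1 : ∀ μ : EuclideanSpace ℝ (Fin n), s ≤ ‖symb ζ μ‖ →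
      min 1 (s / (2 * Z + 3)) * (1 + ‖μ‖) ≤ ‖symb ζ μ‖ := by
    intro μ hμ
    -- For `‖μ‖ ≥ 2 * Z + 2` the quadratic part gives linear growth; on the remaining ball the
    -- uniform lower bound `s` suffices.
    rcases le_total (2 * Z + 2) ‖μ‖ with h | h
    · have := norm_symb_ge ζ μ
      calc min 1 (s / (2 * Z + 3)) * (1 + ‖μ‖) ≤ 1 * (1 + ‖μ‖) := by
            gcongr; exact min_le_left _ _
        _ ≤ ‖symb ζ μ‖ := by nlinarith
    · calc min 1 (s / (2 * Z + 3)) * (1 + ‖μ‖) ≤ s / (2 * Z + 3) * (2 * Z + 3) := by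
            refine mul_le_mul (min_le_right _ _) (by linarith) (by positivity) (by positivity)
        _ = s := by field_simp
        _ ≤ _ := hμ
  -- comparison of the weight with the frequency
  obtain ⟨A, hA, hwt⟩ : ∃ A > 0, ∀ k, wt k ≤ A * (1 + ‖lat L b k + (Real.pi / L) • b i₀‖) := by
    refine ⟨2 + L / (2 * Real.pi), by positivity, fun k => ?_⟩
    have h3 := norm_le_lat (b := b) hL k
    have h4 : ‖lat L b k‖ ≤ ‖lat L b k + (Real.pi / L) • b i₀‖ + Real.pi / L := by
      have := norm_sub_le (lat L b k + (Real.pi / L) • b i₀) ((Real.pi / L) • b i₀)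
      rwa [add_sub_cancel_right, norm_smul _ (b i₀), b.norm_eq_one, mul_one,
        Real.norm_of_nonneg (by positivity)] at this
    set X := ‖lat L b k + (Real.pi / L) • b i₀‖
    have h5 : L / (2 * Real.pi) * (Real.pi / L) = 1 / 2 := by field_simp
    have h6 : ‖k‖ ≤ L / (2 * Real.pi) * X + 1 / 2 := by
      rw [← h5, ← mul_add]
      exact h3.trans (by gcongr)
    have hX : 0 ≤ X := norm_nonneg _
    have hLp : 0 < L / (2 * Real.pi) := by positivity
    unfold wt
    nlinarith
  refine ⟨min 1 (s / (2 * Z + 3)) / A, by positivity, fun k => ?_⟩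
  refine le_trans ?_ (h1 _ (hlow k))
  rw [div_mul_eq_mul_div, div_le_iff₀ hA, mul_assoc, mul_comm _ A]
  gcongr
  exact hwt k

end Symbol

/-- **Complex geometric optics solutions.** For a smooth potential `q` and large null vectors `ζ`
with imaginary part in a fixed direction `e`, there are solutions `exp (i ζ · x) (exp (i η · x) + r)`
of `Δ v = q v` in a ball, with `r = O(1/τ)` in `C¹`. -/
lemma exists_cgo {n : ℕ} {q : EuclideanSpace ℝ (Fin n) → ℂ} (hq : ContDiff ℝ ∞ q) {R : ℝ}
    (hR : 0 < R) {e : EuclideanSpace ℝ (Fin n)} (he : ‖e‖ = 1) (η : Fin n → ℂ) :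
    ∃ C τ₀ : ℝ, 0 < τ₀ ∧ ∀ τ ≥ τ₀, ∀ ζ : Fin n → ℂ, (∀ j, (ζ j).im = τ * e j) →
      ∑ j, ζ j ^ 2 = 0 → ∑ j, ζ j * η j = 0 →
      ∃ r : EuclideanSpace ℝ (Fin n) → ℂ, ContDiff ℝ ∞ r ∧
        (∀ x, ‖x‖ ≤ R → ∑ j, partialD j (partialD j fun y => expo ζ y * (expo η y + r y)) x
          = q x * (expo ζ x * (expo η x + r x))) ∧
        ∀ x, ‖r x‖ ≤ C / τ ∧ ∀ j, ‖partialD j r x‖ ≤ C / τ := by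
  have hn : 0 < n := by
    rcases Nat.eq_zero_or_pos n with rfl | h
    · rw [Subsingleton.elim e 0, norm_zero] at he
      exact absurd he zero_ne_one
    · exact h
  obtain ⟨b, rfl⟩ := exists_orthonormalBasis_apply_eq (⟨0, hn⟩ : Fin n) he
  set i₀ : Fin n := ⟨0, hn⟩
  -- With period `8 * R` the cutoff, supported in the ball of radius `2 * R = L / 4`, meets the
  -- support condition of `exists_fourier_series` and still equals one on the ball of radius `R`.
  set L := 8 * R with hLdef
  have hL : 0 < L := by positivity
  have hL4 : L / 4 = 2 * R := by rw [hLdef]; ring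
  let w : EuclideanSpace ℝ (Fin n) := (Real.pi / L) • b i₀
  let χ : ContDiffBump (0 : EuclideanSpace ℝ (Fin n)) := ⟨R, 2 * R, hR, by linarith⟩
  have hχs : ContDiff ℝ ∞ fun x => ((χ x : ℝ) : ℂ) := Complex.ofRealCLM.contDiff.comp χ.contDiff
  have hχ0 : ∀ x, L / 4 < ‖x‖ → χ x = 0 := fun x hx =>
    χ.zero_of_le_dist (by rw [dist_zero_right]; rw [hL4] at hx; exact hx.le)
  have hχ1 : ∀ x, ‖x‖ ≤ R → χ x = 1 := fun x hx =>
    χ.one_of_mem_closedBall (by simpa using hx)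
  set ηη := ∑ j, η j ^ 2 with hηη
  -- Since `ζ · ζ = ζ · η = 0`, the equation for the remainder is `(-Δ - 2i ζ · ∇ + q) r = -(η · η +
  -- q) exp (i η · x)`, whose constant-coefficient part has symbol `symb ζ`. The function `f` is the
  -- right side, cut off; the factor `expo (-cvec w)` below accounts for the shift of the lattice.
  let f : EuclideanSpace ℝ (Fin n) → ℂ := fun x => -(ηη + q x) * expo η x * (χ x : ℂ)
  have hf : ContDiff ℝ ∞ f := (((contDiff_const.add hq).neg).mul (contDiff_expo η)).mul hχs
  obtain ⟨qc, hqc, hqsum⟩ := exists_fourier_series hL b (f := fun x => q x * (χ x : ℂ))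
    (hq.mul hχs) (fun x hx => by simp [hχ0 x hx])
  obtain ⟨fc, hfc, hfsum⟩ := exists_fourier_series hL b (f := fun x => expo (-cvec w) x * f x)
    ((contDiff_expo _).mul hf) (fun x hx => by simp [f, hχ0 x hx])
  -- Of the weight exponent `2 * n + 1`, the part `2 * n` pays for summation of the series and the
  -- last power for one derivative.
  obtain ⟨C, s₀, hs₀, hC0, hsol⟩ := exists_conv_solution hqc hfc (2 * n + 1)
  let μ : (Fin n → ℤ) → EuclideanSpace ℝ (Fin n) := fun k => lat L b k + w
  obtain ⟨M, hM0, hM⟩ : ∃ M, 0 ≤ M ∧ ∀ k, ‖μ k‖ ≤ M * wt k := by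
    refine ⟨2 * Real.pi / L * n + ‖w‖, by positivity, fun k => ?_⟩
    have h1 := norm_add_le (lat L b k) w
    have h2 := norm_lat_le (b := b) hL k
    have h3 : 0 ≤ 2 * Real.pi / L * n := by positivity
    unfold wt
    nlinarith [norm_nonneg w, norm_nonneg k]
  set S := ∑' k : Fin n → ℤ, ((wt k) ^ (2 * n))⁻¹
  have hS0 : 0 ≤ S := tsum_nonneg fun k => by have := wt_pos k; positivity
  set κ := 2 * Real.pi / L with hκ
  have hκ0 : 0 < κ := by positivity
  refine ⟨(1 + M) * (C / κ) * S, s₀ / κ, by positivity, fun τ hτ ζ hζ hnull hζη => ?_⟩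
  have hτ0 : 0 < τ := lt_of_lt_of_le (by positivity) hτ
  obtain ⟨hσ1, hσ2⟩ := symb_bounds (b := b) hL hτ0 hζ
  have hsτ : s₀ ≤ 2 * Real.pi * τ / L := by
    have : 2 * Real.pi * τ / L = τ * κ := by rw [hκ]; ring
    rw [this]
    exact (div_le_iff₀ hκ0).1 hτ
  obtain ⟨c, hc, hceq, hcb⟩ := hsol _ hsτ (fun k => symb ζ (μ k)) hσ1 hσ2
  have hCs : C / (2 * Real.pi * τ / L) = C / κ / τ := by
    rw [hκ]; field_simp
  rw [hCs] at hcb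
  have hB0 : 0 ≤ C / κ / τ := by positivity
  refine ⟨expSeries μ c, contDiff_expSeries hM hc, ?_, ?_⟩
  · intro x hx
    have hxL : ‖x‖ ≤ L / 4 := by rw [hL4]; linarith
    have hexp : ∀ k, expo (cvec (μ k)) x = expo (cvec (lat L b k)) x * expo (cvec w) x :=
      fun k => by rw [← expo_add, ← cvec_add]
    have hA : expSeries μ fc x = f x := by
      unfold expSeries
      simp_rw [hexp, ← mul_assoc]
      rw [tsum_mul_right, (hfsum x hxL).tsum_eq, mul_right_comm, ← expo_add]
      simp
    have hB : expSeries μ (conv qc c) x = q x * χ x * expSeries μ c x := by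
      unfold expSeries
      simp_rw [hexp, ← mul_assoc]
      rw [tsum_mul_right, tsum_mul_right, ← tsum_mul_tsum_eq_tsum_conv hqc hc
        (fun k => norm_expo_cvec _ x) (fun k l => by rw [lat_add, cvec_add, expo_add]),
        (hqsum x hxL).tsum_eq]
      ring
    have hr1 : ∀ j, RapidDecay fun k => Complex.I * ((μ k j : ℂ) + ζ j) * c k := fun j =>
      rapidDecay_mul hc (norm_freq_le hM (ζ j) j)
    have hr2 : ∀ j, RapidDecay fun k => Complex.I * ((μ k j : ℂ) + ζ j) *
        (Complex.I * ((μ k j : ℂ) + ζ j) * c k) := fun j =>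
      rapidDecay_mul (hr1 j) (norm_freq_le hM (ζ j) j)
    have hD : ∀ j, partialD j (partialD j fun y => expo ζ y * (expo η y + expSeries μ c y)) x
        = expo ζ x * ((Complex.I * (η j + ζ j) * (Complex.I * (η j + ζ j) * 1)) * expo η x
        + expSeries μ (fun k => Complex.I * ((μ k j : ℂ) + ζ j) *
          (Complex.I * ((μ k j : ℂ) + ζ j) * c k)) x) := by
      intro j
      have h1 := partialD_cgo hM hc ζ η 1 j
      simp only [one_mul] at h1
      rw [h1, partialD_cgo hM (hr1 j)]
    have hsymb : ∑ j, expSeries μ (fun k => Complex.I * ((μ k j : ℂ) + ζ j) *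
          (Complex.I * ((μ k j : ℂ) + ζ j) * c k)) x
        = expSeries μ (conv qc c) x - expSeries μ fc x := by
      unfold expSeries
      rw [← (summable_expSeries (conv_rapidDecay hqc hc) x).tsum_sub (summable_expSeries hfc x),
        ← Summable.tsum_finsetSum fun j _ => summable_expSeries (hr2 j) x]
      refine tsum_congr fun k => ?_
      rw [← Finset.sum_mul, ← sub_mul, ← hceq k]
      congr 1
      have : symb ζ (μ k) = ∑ j, ((μ k j : ℂ) + ζ j) ^ 2 := by
        have h2 : ∑ j, ((μ k j : ℂ) + ζ j) ^ 2 = symb ζ (μ k) + ∑ j, ζ j ^ 2 := by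
          rw [symb, ← Finset.sum_add_distrib]
          exact Finset.sum_congr rfl fun j _ => by ring
        rw [h2, hnull, add_zero]
      rw [this, sub_add_eq_sub_sub_swap, sub_self, zero_sub, Finset.sum_mul, ← Finset.sum_neg_distrib]
      refine Finset.sum_congr rfl fun j _ => ?_
      linear_combination (((μ k j : ℂ) + ζ j) ^ 2 * c k) * Complex.I_sq
    have hηζ : ∑ j, Complex.I * (η j + ζ j) * (Complex.I * (η j + ζ j) * 1) = -ηη := by
      have h2 : ∑ j, Complex.I * (η j + ζ j) * (Complex.I * (η j + ζ j) * 1)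
          = -(ηη + 2 * ∑ j, ζ j * η j + ∑ j, ζ j ^ 2) := by
        rw [hηη, Finset.mul_sum, ← Finset.sum_add_distrib, ← Finset.sum_add_distrib,
          ← Finset.sum_neg_distrib]
        refine Finset.sum_congr rfl fun j _ => ?_
        linear_combination ((η j + ζ j) ^ 2) * Complex.I_sq
      rw [h2, hζη, hnull]
      ring
    simp_rw [hD]
    rw [← Finset.mul_sum, Finset.sum_add_distrib, ← Finset.sum_mul, hηζ, hsymb, hA, hB]
    simp only [f, hχ1 x hx]
    push_cast
    ring
  · intro x
    have hb1 : ∀ k, wt k ^ (2 * n) * (wt k * ‖c k‖) ≤ C / κ / τ := fun k => by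
      rw [← mul_assoc, ← pow_succ]; exact hcb k
    have hfin : ∀ {B : ℝ} {c' : (Fin n → ℤ) → ℂ}, B ≤ 1 + M →
        (∀ k, ‖c' k‖ ≤ B * (wt k * ‖c k‖)) → ‖expSeries μ c' x‖ ≤ (1 + M) * (C / κ) * S / τ := by
      intro B c' hB hc'
      have h1 : ∀ k, wt k ^ (2 * n) * ‖c' k‖ ≤ (1 + M) * (C / κ / τ) := fun k => by
        have hw := wt_pos k
        calc wt k ^ (2 * n) * ‖c' k‖ ≤ wt k ^ (2 * n) * ((1 + M) * (wt k * ‖c k‖)) := by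
              gcongr
              exact (hc' k).trans (by gcongr)
          _ = (1 + M) * (wt k ^ (2 * n) * (wt k * ‖c k‖)) := by ring
          _ ≤ _ := by gcongr; exact hb1 k
      refine (norm_expSeries_le h1 x).trans (le_of_eq ?_)
      change _ * S = _
      ring
    refine ⟨hfin (B := 1) (by linarith) fun k => ?_, fun j => ?_⟩
    · rw [one_mul]
      exact le_mul_of_one_le_left (norm_nonneg _) (one_le_wt k)
    · rw [partialD_expSeries hM hc]
      refine hfin (B := M) (by linarith) fun k => ?_
      rw [norm_mul, norm_mul, Complex.norm_I, one_mul, ← mul_assoc]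
      gcongr
      exact (norm_apply_le_norm _ _).trans (hM k)

/-! ### Reduction of the conductivity equation to a Schrödinger equation -/

/-- A smooth extension `g` of `γ₀` may lose positivity away from the closure, so it is blended with
the constant `1` by a cutoff that vanishes where `g ≤ 0`. This gives a globally positive function
with a smooth square root. -/
lemma exists_smooth_sqrt {n : ℕ} {Ω : Set (EuclideanSpace ℝ (Fin n))}
    {γ₀ : EuclideanSpace ℝ (Fin n) → ℝ} (hγ₀s : SmoothOnClosure Ω γ₀)
    (hγ₀p : ∀ x ∈ closure Ω, 0 < γ₀ x) :
    ∃ β : EuclideanSpace ℝ (Fin n) → ℂ, ContDiff ℝ ∞ β ∧ (∀ x, β x ≠ 0) ∧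
      ∀ x ∈ closure Ω, (γ₀ x : ℂ) = β x ^ 2 := by
  obtain ⟨g, hg, hgγ⟩ := hγ₀s
  have hU : IsClosed {x | 0 < g x}ᶜ := (isOpen_lt continuous_const hg.continuous).isClosed_compl
  have hdisj : Disjoint {x | 0 < g x}ᶜ (closure Ω) := by
    rw [Set.disjoint_left]
    intro x hx hx'
    exact hx (by rw [Set.mem_ofPred_eq, ← hgγ hx']; exact hγ₀p x hx')
  obtain ⟨χ, hχ0, hχ1, hχ⟩ := exists_contMDiffMap_zero_one_of_isClosed
    (modelWithCornersSelf ℝ (EuclideanSpace ℝ (Fin n))) (n := ⊤) hU isClosed_closure hdisj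
  have hχs : ContDiff ℝ ∞ χ := χ.contMDiff.contDiff
  let G : EuclideanSpace ℝ (Fin n) → ℝ := fun x => χ x * g x + (1 - χ x)
  have hG : ContDiff ℝ ∞ G := (hχs.mul hg).add (contDiff_const.sub hχs)
  have hGp : ∀ x, 0 < G x := by
    intro x
    by_cases hx : 0 < g x
    · have h0 := (hχ x).1
      have h1 := (hχ x).2
      rcases h0.eq_or_lt with h | h
      · simp [G, ← h]
      · have := mul_pos h hx
        simp only [G]; linarith
    · have : χ x = 0 := hχ0 hx
      simp [G, this]
  refine ⟨fun x => (Real.sqrt (G x) : ℂ),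
    Complex.ofRealCLM.contDiff.comp (hG.sqrt fun x => (hGp x).ne'),
    fun x => Complex.ofReal_ne_zero.2 (Real.sqrt_pos.2 (hGp x)).ne', fun x hx => ?_⟩
  have h1 : χ x = 1 := hχ1 hx
  have h2 : G x = γ₀ x := by simp [G, h1, hgγ hx]
  rw [← Complex.ofReal_pow, Real.sq_sqrt (hGp x).le, h2]

/-- If `Δ v = (Δ β / β) v`, then `β⁻¹ v` solves the conductivity equation for `γ₀ = β ^ 2`. -/
lemma isSmoothSolution_of_schrodinger {n : ℕ} {Ω : Set (EuclideanSpace ℝ (Fin n))}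
    (hΩ : IsOpen Ω) {γ₀ : EuclideanSpace ℝ (Fin n) → ℝ} {β v : EuclideanSpace ℝ (Fin n) → ℂ}
    (hβ : ContDiff ℝ ∞ β) (hβ0 : ∀ x, β x ≠ 0) (hγ : ∀ x ∈ closure Ω, (γ₀ x : ℂ) = β x ^ 2)
    (hv : ContDiff ℝ ∞ v)
    (h : ∀ x ∈ Ω, ∑ j, partialD j (partialD j v) x
      = (∑ j, partialD j (partialD j β) x) / β x * v x) :
    IsSmoothSolution Ω γ₀ (fun x => (β x)⁻¹ * v x) := by
  have hu : ContDiff ℝ ∞ fun x => (β x)⁻¹ * v x := (hβ.inv hβ0).mul hv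
  refine ⟨⟨_, hu, fun _ _ => rfl⟩, fun x hx => ?_⟩
  have hdβ := hβ.differentiable (by simp)
  have hdv := hv.differentiable (by simp)
  have hdu := hu.differentiable (by simp)
  -- The flux is `γ₀ ∇u = β ∇v - v ∇β`; in its divergence the first-order products cancel and `β Δv
  -- - v Δβ` remains.
  have hflux : ∀ i, ∀ y ∈ Ω, (γ₀ y : ℂ) * partialD i (fun x => (β x)⁻¹ * v x) y
      = β y * partialD i v y - v y * partialD i β y := by
    intro i y hy
    have h1 : partialD i v y = partialD i β y * ((β y)⁻¹ * v y)
        + β y * partialD i (fun x => (β x)⁻¹ * v x) y := by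
      rw [← partialD_mul (hdβ y) (hdu y)]
      congr 1
      funext z
      rw [mul_inv_cancel_left₀ (hβ0 z)]
    rw [hγ y (subset_closure hy), h1]
    have := hβ0 y
    field_simp
    ring
  have hterm : ∀ i, partialD i (fun y => (γ₀ y : ℂ) * partialD i (fun x => (β x)⁻¹ * v x) y) x
      = β x * partialD i (partialD i v) x - v x * partialD i (partialD i β) x := by
    intro i
    have hpv := (contDiff_partialD hv i).differentiable (by simp)
    have hpβ := (contDiff_partialD hβ i).differentiable (by simp)
    have h1 : (fun y => (γ₀ y : ℂ) * partialD i (fun x => (β x)⁻¹ * v x) y)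
        =ᶠ[𝓝 x] fun y => β y * partialD i v y - v y * partialD i β y :=
      Filter.eventually_of_mem (hΩ.mem_nhds hx) (hflux i)
    rw [partialD_congr h1, partialD_sub ((hdβ x).fun_mul (hpv x)) ((hdv x).fun_mul (hpβ x)),
      partialD_mul (hdβ x) (hpv x), partialD_mul (hdv x) (hpβ x)]
    ring
  simp_rw [hterm]
  rw [Finset.sum_sub_distrib, ← Finset.mul_sum, ← Finset.mul_sum, h x hx]
  have := hβ0 x
  field_simp
  ring

lemma isSmoothSolution_zero {n : ℕ} (Ω : Set (EuclideanSpace ℝ (Fin n)))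
    (γ₀ : EuclideanSpace ℝ (Fin n) → ℝ) : IsSmoothSolution Ω γ₀ fun _ => 0 := by
  refine ⟨⟨_, contDiff_const, fun _ _ => rfl⟩, fun x _ => ?_⟩
  simp [partialD]

lemma exists_bound_of_isBounded {n : ℕ} {Ω : Set (EuclideanSpace ℝ (Fin n))}
    (hΩb : Bornology.IsBounded Ω) {a : EuclideanSpace ℝ (Fin n) → ℂ} (ha : ContDiff ℝ ∞ a) :
    ∃ D, 0 ≤ D ∧ ∀ x ∈ Ω, ‖a x‖ ≤ D ∧ ∀ j, ‖partialD j a x‖ ≤ D := by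
  have hK : IsCompact (closure Ω) := hΩb.isCompact_closure
  have hcont : Continuous fun x => (a x, fun j => partialD j a x) :=
    ha.continuous.prodMk (continuous_pi fun j => (contDiff_partialD ha j).continuous)
  obtain ⟨D, hD⟩ := hK.exists_bound_of_continuousOn hcont.continuousOn
  refine ⟨max D 0, le_max_right _ _, fun x hx => ?_⟩
  have h1 := hD x (subset_closure hx)
  rw [Prod.norm_def, max_le_iff] at h1
  exact ⟨h1.1.trans (le_max_left _ _),
    fun j => ((norm_le_pi_norm (fun j => partialD j a x) j).trans h1.2).trans (le_max_left _ _)⟩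

/-- Sequences of complex geometric optics solutions of the conductivity equation, with amplitudes
converging to `β⁻¹ exp (i η · x)` in `C¹`, boundedly and pointwise. -/
lemma exists_cgo_seq {n : ℕ} {Ω : Set (EuclideanSpace ℝ (Fin n))} (hΩ : IsOpen Ω)
    (hΩb : Bornology.IsBounded Ω) {γ₀ : EuclideanSpace ℝ (Fin n) → ℝ}
    {β : EuclideanSpace ℝ (Fin n) → ℂ}
    (hβ : ContDiff ℝ ∞ β) (hβ0 : ∀ x, β x ≠ 0) (hγ : ∀ x ∈ closure Ω, (γ₀ x : ℂ) = β x ^ 2)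
    {e : EuclideanSpace ℝ (Fin n)} (he : ‖e‖ = 1) (η : Fin n → ℂ) {ζ : ℕ → Fin n → ℂ} {τ : ℕ → ℝ}
    (hτ : Tendsto τ atTop atTop) (him : ∀ N j, (ζ N j).im = τ N * e j)
    (hnull : ∀ N, ∑ j, ζ N j ^ 2 = 0) (hζη : ∀ N, ∑ j, ζ N j * η j = 0) :
    ∃ A : ℕ → EuclideanSpace ℝ (Fin n) → ℂ, (∀ N, ContDiff ℝ ∞ (A N)) ∧
      (∀ N, IsSmoothSolution Ω γ₀ fun x => expo (ζ N) x * A N x) ∧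
      (∃ C, ∀ N, ∀ x ∈ Ω, ‖A N x‖ ≤ C ∧ ∀ j, ‖partialD j (A N) x‖ ≤ C) ∧
      ∀ x ∈ Ω, Tendsto (fun N => A N x) atTop (𝓝 ((β x)⁻¹ * expo η x)) ∧
        ∀ j, Tendsto (fun N => partialD j (A N) x) atTop
          (𝓝 (partialD j (fun y => (β y)⁻¹ * expo η y) x)) := by
  obtain ⟨R, hR, hΩR⟩ : ∃ R > 0, ∀ x ∈ Ω, ‖x‖ ≤ R := hΩb.exists_pos_norm_le
  set ρ : EuclideanSpace ℝ (Fin n) → ℂ := fun y => (β y)⁻¹ with hρdef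
  set a : EuclideanSpace ℝ (Fin n) → ℂ := fun y => (β y)⁻¹ * expo η y with hadef
  have hρ : ContDiff ℝ ∞ ρ := hβ.inv hβ0
  have ha : ContDiff ℝ ∞ a := hρ.mul (contDiff_expo η)
  have hq : ContDiff ℝ ∞ fun x => (∑ j, partialD j (partialD j β) x) / β x := by
    simp_rw [div_eq_mul_inv]
    exact (ContDiff.sum fun j _ => contDiff_partialD (contDiff_partialD hβ j) j).mul hρ
  obtain ⟨C, τ₀, hτ₀, hcgo⟩ := exists_cgo hq hR he η
  obtain ⟨D, hD0, hD⟩ := exists_bound_of_isBounded hΩb hρ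
  obtain ⟨D', hD'0, hD'⟩ := exists_bound_of_isBounded hΩb ha
  have key : ∀ N, ∃ A : EuclideanSpace ℝ (Fin n) → ℂ, ContDiff ℝ ∞ A ∧
      (IsSmoothSolution Ω γ₀ fun x => expo (ζ N) x * A x) ∧
      (τ₀ ≤ τ N → ∀ x ∈ Ω, ‖A x - a x‖ ≤ 2 * D * C / τ N ∧
        ∀ j, ‖partialD j A x - partialD j a x‖ ≤ 2 * D * C / τ N) ∧
      (τ N < τ₀ → A = fun _ => 0) := by
    intro N
    by_cases hN : τ₀ ≤ τ N
    · obtain ⟨r, hr, hsol, hrb⟩ := hcgo (τ N) hN (ζ N) (him N) (hnull N) (hζη N)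
      refine ⟨fun x => a x + ρ x * r x, ha.add (hρ.mul hr), ?_, fun _ x hx => ?_,
        fun h => absurd hN (not_le.2 h)⟩
      · have h1 := isSmoothSolution_of_schrodinger hΩ hβ hβ0 hγ
          ((contDiff_expo (ζ N)).mul ((contDiff_expo η).add hr)) (fun x hx => hsol x (hΩR x hx))
        convert h1 using 2
        simp only [a, ρ]
        ring
      · have hτN : 0 < τ N := hτ₀.trans_le hN
        have hC0 : 0 ≤ C / τ N := (norm_nonneg _).trans (hrb x).1
        obtain ⟨hρ1, hρ2⟩ := hD x hx
        obtain ⟨hr1, hr2⟩ := hrb x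
        have h2 : 2 * D * C / τ N = D * (C / τ N) + D * (C / τ N) := by ring
        refine ⟨?_, fun j => ?_⟩
        · rw [add_sub_cancel_left, norm_mul, h2]
          have := mul_le_mul hρ1 hr1 (norm_nonneg _) hD0
          have := mul_nonneg hD0 hC0
          linarith
        · have hda := ha.differentiable (by simp) x
          have hdρ := hρ.differentiable (by simp) x
          have hdr := hr.differentiable (by simp) x
          rw [partialD_add hda (hdρ.fun_mul hdr), add_sub_cancel_left, partialD_mul hdρ hdr, h2]
          refine (norm_add_le _ _).trans (add_le_add ?_ ?_)
          · rw [norm_mul]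
            exact mul_le_mul (hρ2 j) hr1 (norm_nonneg _) hD0
          · rw [norm_mul]
            exact mul_le_mul hρ1 (hr2 j) (norm_nonneg _) hD0
    -- For the indices with `τ N` below the threshold the zero solution serves as a default. It
    -- keeps the bounds uniform and does not affect the limit.
    · refine ⟨fun _ => 0, contDiff_const, ?_, fun h => absurd h hN, fun _ => rfl⟩
      simpa using isSmoothSolution_zero Ω γ₀
  choose A hA1 hA2 hA3 hA4 using key
  refine ⟨A, hA1, hA2, ⟨D' + |2 * D * C| / τ₀, fun N x hx => ?_⟩, fun x hx => ?_⟩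
  · rcases le_or_gt τ₀ (τ N) with hN | hN
    · obtain ⟨h1, h2⟩ := hA3 N hN x hx
      obtain ⟨h3, h4⟩ := hD' x hx
      have h5 : 2 * D * C / τ N ≤ |2 * D * C| / τ₀ :=
        div_le_div₀ (abs_nonneg _) (le_abs_self _) hτ₀ hN
      refine ⟨?_, fun j => ?_⟩
      · have := norm_le_norm_add_norm_sub' (A N x) (a x)
        linarith
      · have := norm_le_norm_add_norm_sub' (partialD j (A N) x) (partialD j a x)
        linarith [h2 j, h4 j]
    · have hp : 0 ≤ D' + |2 * D * C| / τ₀ := by positivity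
      rw [hA4 N hN]
      exact ⟨by simpa using hp, fun j => by simpa [partialD] using hp⟩
  · have hz : Tendsto (fun N => 2 * D * C / τ N) atTop (𝓝 0) := tendsto_const_nhds.div_atTop hτ
    have hev := hτ.eventually_ge_atTop τ₀
    refine ⟨?_, fun j => ?_⟩
    · rw [tendsto_iff_norm_sub_tendsto_zero]
      refine squeeze_zero' (Eventually.of_forall fun _ => norm_nonneg _) ?_ hz
      filter_upwards [hev] with N hN
      exact (hA3 N hN x hx).1
    · rw [tendsto_iff_norm_sub_tendsto_zero]
      refine squeeze_zero' (Eventually.of_forall fun _ => norm_nonneg _) ?_ hz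
      filter_upwards [hev] with N hN
      exact (hA3 N hN x hx).2 j

/-! ### Uniqueness for the Fourier transform, and passage to the limit -/

lemma integrableOn_of_continuousOn_closure {n : ℕ} {Ω : Set (EuclideanSpace ℝ (Fin n))}
    (hΩb : Bornology.IsBounded Ω) {f : EuclideanSpace ℝ (Fin n) → ℂ}
    (hf : ContinuousOn f (closure Ω)) : IntegrableOn f Ω :=
  (hf.integrableOn_compact hΩb.isCompact_closure).mono_set subset_closure

/-- The extension of `f` by zero is integrable with vanishing Fourier transform, and Fourier
inversion holds at its continuity points, which include all of the open set `Ω`. -/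
lemma eq_zero_of_fourier_eq_zero {n : ℕ} {Ω : Set (EuclideanSpace ℝ (Fin n))} (hΩ : IsOpen Ω)
    (hΩb : Bornology.IsBounded Ω) {f : EuclideanSpace ℝ (Fin n) → ℂ}
    (hf : ContinuousOn f (closure Ω))
    (h : ∀ ξ : EuclideanSpace ℝ (Fin n), ∫ x in Ω, f x * expo (cvec ξ) x = 0) :
    ∀ x ∈ Ω, f x = 0 := by
  intro x hx
  have hInt : Integrable (Ω.indicator f) :=
    (integrable_indicator_iff hΩ.measurableSet).2 (integrableOn_of_continuousOn_closure hΩb hf)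
  have hF : FourierTransform.fourier (Ω.indicator f) = 0 := by
    funext w
    rw [Real.fourier_eq', Pi.zero_apply, ← h (-(2 * Real.pi) • w),
      ← integral_indicator hΩ.measurableSet]
    congr 1
    funext y
    by_cases hy : y ∈ Ω
    · rw [Set.indicator_of_mem hy, Set.indicator_of_mem hy, smul_eq_mul, mul_comm, expo, dotL_cvec,
        inner_smul_left, real_inner_comm, mul_comm _ Complex.I]
      simp
    · rw [Set.indicator_of_notMem hy, Set.indicator_of_notMem hy, smul_zero]
  have hcont : ContinuousAt (Ω.indicator f) x := by
    refine (hf.continuousAt (mem_of_superset (hΩ.mem_nhds hx) subset_closure)).congr ?_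
    filter_upwards [hΩ.mem_nhds hx] with y hy
    rw [Set.indicator_of_mem hy]
  have hinv := hInt.fourierInv_fourier_eq (by rw [hF]; exact integrable_zero _ _ _) hcont
  rw [hF, Set.indicator_of_mem hx] at hinv
  rw [← hinv, Real.fourierInv_eq]
  simp

/-- Every solution enters each term of the identity exactly once, so scalar factors of the gradients
multiply to the same quantity for all permutations. -/
lemma prod_castSucc_perm {m : ℕ} {M : Type*} [CommMonoid M] (g : Fin (m + 2) → M)
    (l : Equiv.Perm (Fin (m + 1))) :
    (∏ k : Fin m, g (l k.castSucc).castSucc) * (g (l (Fin.last m)).castSucc * g (Fin.last (m + 1)))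
      = ∏ k, g k := by
  rw [Fin.prod_univ_castSucc (n := m + 1), ← Equiv.prod_comp l, Fin.prod_univ_castSucc, mul_assoc]

/-- If the gradients of a sequence of solutions factor as a scalar times bounded convergent vector
fields, where the scalars multiply up to a nonzero constant, then the integral identity passes to
the limit. -/
lemma integral_identity_limit {n m : ℕ} {Ω : Set (EuclideanSpace ℝ (Fin n))} (hΩ : IsOpen Ω)
    (hΩb : Bornology.IsBounded Ω) {γ₀ : EuclideanSpace ℝ (Fin n) → ℝ}
    {T : EuclideanSpace ℝ (Fin n) → (Fin m → Fin n) → ℂ} (hTc : ContinuousOn T (closure Ω))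
    (hT : ∀ u : Fin (m + 2) → EuclideanSpace ℝ (Fin n) → ℂ,
      (∀ l, IsSmoothSolution Ω γ₀ (u l)) →
      ∑ l : Equiv.Perm (Fin (m + 1)), ∑ j : Fin m → Fin n,
        ∫ x in Ω, T x j
          * (∏ k : Fin m, partialD (j k) (u (l k.castSucc).castSucc) x)
          * gradDot (u (l (Fin.last m)).castSucc) (u (Fin.last (m + 1))) x = 0)
    {u : ℕ → Fin (m + 2) → EuclideanSpace ℝ (Fin n) → ℂ}
    (hu : ∀ N l, IsSmoothSolution Ω γ₀ (u N l))
    {g : ℕ → Fin (m + 2) → EuclideanSpace ℝ (Fin n) → ℂ}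
    {B : ℕ → Fin (m + 2) → Fin n → EuclideanSpace ℝ (Fin n) → ℂ}
    {B' : Fin (m + 2) → Fin n → EuclideanSpace ℝ (Fin n) → ℂ} {κ : ℕ → ℂ} (hκ : ∀ N, κ N ≠ 0)
    (hfac : ∀ N l i, ∀ x ∈ Ω, partialD i (u N l) x = g N l x * B N l i x)
    (hg : ∀ N, ∀ x ∈ Ω, ∏ l, g N l x = κ N)
    (hBc : ∀ N l i, ContinuousOn (B N l i) Ω)
    (hBb : ∃ C, ∀ N l i, ∀ x ∈ Ω, ‖B N l i x‖ ≤ C)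
    (hB : ∀ l i, ∀ x ∈ Ω, Tendsto (fun N => B N l i x) atTop (𝓝 (B' l i x))) :
    ∑ l : Equiv.Perm (Fin (m + 1)), ∑ j : Fin m → Fin n,
      ∫ x in Ω, T x j * (∏ k : Fin m, B' (l k.castSucc).castSucc (j k) x)
        * ∑ i, B' (l (Fin.last m)).castSucc i x * B' (Fin.last (m + 1)) i x = 0 := by
  obtain ⟨C, hC⟩ := hBb
  have hC' : ∀ N l i, ∀ x ∈ Ω, ‖B N l i x‖ ≤ max C 0 := fun N l i x hx =>
    (hC N l i x hx).trans (le_max_left _ _)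
  have hC0 : 0 ≤ max C 0 := le_max_right _ _
  obtain ⟨D, hD⟩ := hΩb.isCompact_closure.exists_bound_of_continuousOn hTc
  have hD0 : ∀ x ∈ Ω, 0 ≤ D := fun x hx => (norm_nonneg _).trans (hD x (subset_closure hx))
  have hzero : ∀ N, ∑ l : Equiv.Perm (Fin (m + 1)), ∑ j : Fin m → Fin n,
      ∫ x in Ω, T x j * (∏ k : Fin m, B N (l k.castSucc).castSucc (j k) x)
        * ∑ i, B N (l (Fin.last m)).castSucc i x * B N (Fin.last (m + 1)) i x = 0 := by
    intro N
    have h1 := hT (u N) (hu N)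
    have h2 : ∀ (l : Equiv.Perm (Fin (m + 1))) (j : Fin m → Fin n),
        ∫ x in Ω, T x j * (∏ k : Fin m, partialD (j k) (u N (l k.castSucc).castSucc) x)
          * gradDot (u N (l (Fin.last m)).castSucc) (u N (Fin.last (m + 1))) x
        = κ N * ∫ x in Ω, T x j * (∏ k : Fin m, B N (l k.castSucc).castSucc (j k) x)
        * ∑ i, B N (l (Fin.last m)).castSucc i x * B N (Fin.last (m + 1)) i x := by
      intro l j
      rw [← integral_const_mul]
      refine setIntegral_congr_fun hΩ.measurableSet fun x hx => ?_
      simp only [gradDot, hfac N _ _ x hx]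
      rw [← hg N x hx, ← prod_castSucc_perm (fun k => g N k x) l, Finset.prod_mul_distrib,
        Finset.mul_sum, Finset.mul_sum, Finset.mul_sum]
      exact Finset.sum_congr rfl fun i _ => by ring
    simp_rw [h2, ← Finset.mul_sum] at h1
    exact (mul_eq_zero.1 h1).resolve_left (hκ N)
  have hlim : Tendsto (fun N => ∑ l : Equiv.Perm (Fin (m + 1)), ∑ j : Fin m → Fin n,
      ∫ x in Ω, T x j * (∏ k : Fin m, B N (l k.castSucc).castSucc (j k) x)
        * ∑ i, B N (l (Fin.last m)).castSucc i x * B N (Fin.last (m + 1)) i x) atTop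
      (𝓝 (∑ l : Equiv.Perm (Fin (m + 1)), ∑ j : Fin m → Fin n,
      ∫ x in Ω, T x j * (∏ k : Fin m, B' (l k.castSucc).castSucc (j k) x)
        * ∑ i, B' (l (Fin.last m)).castSucc i x * B' (Fin.last (m + 1)) i x)) := by
    refine tendsto_finsetSum _ fun l _ => tendsto_finsetSum _ fun j _ => ?_
    refine tendsto_integral_of_dominated_convergence
      (fun _ => D * (max C 0) ^ m * (n * (max C 0 * max C 0))) (fun N => ?_) ?_ (fun N => ?_) ?_
    · refine ContinuousOn.aestronglyMeasurable ?_ hΩ.measurableSet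
      refine ((continuousOn_pi.1 (hTc.mono subset_closure) j).mul
        (continuousOn_finsetProd _ fun k _ => hBc _ _ _)).mul
        (continuousOn_finsetSum _ fun i _ => (hBc _ _ _).mul (hBc _ _ _))
    · exact integrableOn_const hΩb.measure_lt_top.ne
    · refine (ae_restrict_iff' hΩ.measurableSet).2 (Eventually.of_forall fun x hx => ?_)
      rw [norm_mul, norm_mul]
      have hd := hD0 x hx
      refine mul_le_mul (mul_le_mul ((norm_le_pi_norm (T x) j).trans (hD x (subset_closure hx))) ?_
        (norm_nonneg _) hd) ?_ (norm_nonneg _) (by positivity)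
      · rw [norm_prod]
        refine (Finset.prod_le_prod (fun _ _ => norm_nonneg _) fun k _ => hC' N _ _ x hx).trans ?_
        simp
      · refine (norm_sum_le _ _).trans ((Finset.sum_le_sum (g := fun _ => max C 0 * max C 0)
          fun i _ => ?_).trans ?_)
        · rw [norm_mul]
          exact mul_le_mul (hC' N _ _ x hx) (hC' N _ _ x hx) (norm_nonneg _) hC0
        · simp
    · refine (ae_restrict_iff' hΩ.measurableSet).2 (Eventually.of_forall fun x hx => ?_)
      exact (tendsto_const_nhds.mul (tendsto_finsetProd _ fun k _ => hB _ _ x hx)).mul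
        (tendsto_finsetSum _ fun i _ => (hB _ _ x hx).mul (hB _ _ x hx))
  simp_rw [hzero] at hlim
  exact (tendsto_nhds_unique hlim tendsto_const_nhds)

/-! ### Contractions of symmetric tensors -/

/-- The contraction `∑ t^{j₁…j_m} Z₁_{j₁} ⋯ Z_m_{j_m}` as a multilinear map in `Z`. -/
def contr {n m : ℕ} (t : (Fin m → Fin n) → ℂ) :
    MultilinearMap ℂ (fun _ : Fin m => Fin n → ℂ) ℂ :=
  ∑ j, t j • (MultilinearMap.mkPiAlgebra ℂ (Fin m) ℂ).compLinearMap fun k => LinearMap.proj (j k)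

lemma contr_apply {n m : ℕ} (t : (Fin m → Fin n) → ℂ) (Z : Fin m → Fin n → ℂ) :
    contr t Z = ∑ j, t j * ∏ k, Z k (j k) := by
  simp [contr]

lemma contr_comp_perm {n m : ℕ} {t : (Fin m → Fin n) → ℂ} (ht : IsSymmTensor t)
    (Z : Fin m → Fin n → ℂ) (σ : Equiv.Perm (Fin m)) :
    contr t (fun k => Z (σ k)) = contr t Z := by
  rw [contr_apply, contr_apply, ← Equiv.sum_comp (σ.symm.arrowCongr (Equiv.refl (Fin n)))]
  refine Finset.sum_congr rfl fun j _ => ?_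
  have h1 : (σ.symm.arrowCongr (Equiv.refl (Fin n))) j = j ∘ σ := rfl
  rw [h1, ht σ j, ← Equiv.prod_comp σ (fun k => Z k (j k))]
  rfl

/-- A symmetric tensor is determined by its values on the diagonal. -/
lemma eq_zero_of_contr_diag_eq_zero {n m : ℕ} {t : (Fin m → Fin n) → ℂ} (ht : IsSymmTensor t)
    (h : ∀ v : EuclideanSpace ℝ (Fin n), contr t (fun _ => cvec v) = 0) : t = 0 := by
  let f : ContinuousMultilinearMap ℝ (fun _ : Fin m => EuclideanSpace ℝ (Fin n)) ℂ :=
    ∑ j, t j • (ContinuousMultilinearMap.mkPiAlgebra ℝ (Fin m) ℂ).compContinuousLinearMap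
      fun k => Complex.ofRealCLM.comp (EuclideanSpace.proj (j k))
  have hf : ∀ v, f v = contr t (fun k => cvec (v k)) := by
    intro v
    simp [f, contr_apply]
  funext j₀
  -- Polarization: the `m`-th derivative of the diagonal restriction is the sum of `f` over permuted
  -- arguments, which symmetry makes `m!` times one component.
  have h1 := f.iteratedFDeriv_comp_diagonal 0 (fun k => EuclideanSpace.single (j₀ k) (1 : ℝ))
  have h2 : (fun x => f fun _ => x) = fun _ => 0 := by
    funext x
    rw [hf, h]
  have h3 : ∀ j : Fin m → Fin n,
      contr t (fun k => cvec (EuclideanSpace.single (j k) (1 : ℝ))) = t j := by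
    intro j
    rw [contr_apply, Finset.sum_eq_single j]
    · simp
    · intro j' _ hj'
      obtain ⟨k, hk⟩ := Function.ne_iff.1 hj'
      rw [Finset.prod_eq_zero (Finset.mem_univ k), mul_zero]
      simp [hk]
    · simp
  have h4 : ∀ σ : Equiv.Perm (Fin m),
      f (fun i => EuclideanSpace.single (j₀ (σ i)) (1 : ℝ)) = t j₀ := by
    intro σ
    rw [hf, h3 fun i => j₀ (σ i)]
    exact ht σ j₀
  rw [h2, Finset.sum_congr rfl fun σ _ => h4 σ] at h1
  have h5 : iteratedFDeriv ℝ m (fun _ : EuclideanSpace ℝ (Fin n) => (0 : ℂ)) = 0 :=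
    iteratedFDeriv_fun_zero
  rw [h5] at h1
  simpa [Nat.factorial_ne_zero] using h1.symm

/-- Homogeneity of degree `m` reduces to unit vectors; at `v = 0` one needs at least one slot, hence
`1 ≤ m`. -/
lemma eq_zero_of_contr_unit_diag_eq_zero {n m : ℕ} (hm : 1 ≤ m) {t : (Fin m → Fin n) → ℂ}
    (ht : IsSymmTensor t)
    (h : ∀ e : EuclideanSpace ℝ (Fin n), ‖e‖ = 1 → contr t (fun _ => cvec e) = 0) : t = 0 := by
  refine eq_zero_of_contr_diag_eq_zero ht fun v => ?_
  by_cases hv : v = 0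
  · subst hv
    exact (contr t).map_coord_zero ⟨0, by omega⟩ (by ext; simp)
  · have hv' : (‖v‖ : ℂ) ≠ 0 := by exact_mod_cast norm_ne_zero_iff.2 hv
    have h1 := h ((‖v‖)⁻¹ • v) (by rw [norm_smul, norm_inv, norm_norm,
      inv_mul_cancel₀ (norm_ne_zero_iff.2 hv)])
    have h2 : (fun _ : Fin m => cvec v) = fun _ => (‖v‖ : ℂ) • cvec ((‖v‖)⁻¹ • v) := by
      funext k j
      simp [hv']
    rw [h2, MultilinearMap.map_smul_univ, h1, smul_zero]

/-! ### Null vectors -/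

/-- The bilinear product `z · w` on `ℂⁿ`. -/
def bdot {n : ℕ} (z w : Fin n → ℂ) : ℂ := ∑ i, z i * w i

lemma bdot_add_right {n : ℕ} (z w w' : Fin n → ℂ) : bdot z (w + w') = bdot z w + bdot z w' := by
  simp [bdot, mul_add, Finset.sum_add_distrib]

lemma bdot_sub_right {n : ℕ} (z w w' : Fin n → ℂ) : bdot z (w - w') = bdot z w - bdot z w' := by
  simp [bdot, mul_sub, Finset.sum_sub_distrib]

lemma bdot_smul_right {n : ℕ} (a : ℂ) (z w : Fin n → ℂ) : bdot z (a • w) = a * bdot z w := by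
  simp only [bdot, Pi.smul_apply, smul_eq_mul, Finset.mul_sum]
  exact Finset.sum_congr rfl fun i _ => by ring

lemma bdot_comm {n : ℕ} (z w : Fin n → ℂ) : bdot z w = bdot w z :=
  Finset.sum_congr rfl fun _ _ => mul_comm _ _

lemma bdot_add_left {n : ℕ} (z z' w : Fin n → ℂ) : bdot (z + z') w = bdot z w + bdot z' w := by
  rw [bdot_comm, bdot_add_right, bdot_comm w, bdot_comm w]

lemma bdot_smul_left {n : ℕ} (a : ℂ) (z w : Fin n → ℂ) : bdot (a • z) w = a * bdot z w := by
  rw [bdot_comm, bdot_smul_right, bdot_comm]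

@[simp] lemma bdot_zero_right {n : ℕ} (z : Fin n → ℂ) : bdot z 0 = 0 := by simp [bdot]

lemma bdot_cvec {n : ℕ} (v w : EuclideanSpace ℝ (Fin n)) :
    bdot (cvec v) (cvec w) = (inner ℝ v w : ℝ) := by
  simp [bdot, PiLp.inner_apply, mul_comm]

/-- A null vector whose imaginary part is nonzero. -/
def IsNullDir {n : ℕ} (z : Fin n → ℂ) : Prop :=
  bdot z z = 0 ∧ ∃ (e : EuclideanSpace ℝ (Fin n)) (t : ℝ), ‖e‖ = 1 ∧ 0 < t ∧ ∀ j, (z j).im = t * e j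

/-- For a negative factor the unit vector is reversed so that the scale `t` stays positive. -/
lemma IsNullDir.smul {n : ℕ} {z : Fin n → ℂ} (hz : IsNullDir z) {a : ℝ} (ha : a ≠ 0) :
    IsNullDir ((a : ℂ) • z) := by
  obtain ⟨h0, e, t, he, ht, him⟩ := hz
  refine ⟨by rw [bdot_smul_left, bdot_smul_right, h0]; simp, ?_⟩
  rcases lt_or_gt_of_ne ha with h | h
  · refine ⟨-e, -a * t, by simpa using he, by nlinarith, fun j => ?_⟩
    simp [him]; ring
  · refine ⟨e, a * t, he, by positivity, fun j => ?_⟩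
    simp [him]; ring

/-- The null vector `e₁ + i e₂` of an orthonormal pair. -/
def nullv {n : ℕ} (e₁ e₂ : EuclideanSpace ℝ (Fin n)) : Fin n → ℂ := cvec e₁ + Complex.I • cvec e₂

lemma bdot_nullv {n : ℕ} (e₁ e₂ f₁ f₂ : EuclideanSpace ℝ (Fin n)) :
    bdot (nullv e₁ e₂) (nullv f₁ f₂) = ((inner ℝ e₁ f₁ - inner ℝ e₂ f₂ : ℝ) : ℂ)
      + Complex.I * ((inner ℝ e₁ f₂ + inner ℝ e₂ f₁ : ℝ) : ℂ) := by
  simp only [nullv, bdot_add_left, bdot_add_right, bdot_smul_left, bdot_smul_right, bdot_cvec]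
  push_cast
  linear_combination ((inner ℝ e₂ f₂ : ℝ) : ℂ) * Complex.I_sq

lemma isNullDir_nullv {n : ℕ} {e₁ e₂ : EuclideanSpace ℝ (Fin n)} (h₁ : ‖e₁‖ = 1) (h₂ : ‖e₂‖ = 1)
    (h₁₂ : inner ℝ e₁ e₂ = 0) : IsNullDir (nullv e₁ e₂) := by
  refine ⟨?_, e₂, 1, h₂, one_pos, fun j => by simp [nullv]⟩
  rw [bdot_nullv, real_inner_self_eq_norm_sq, real_inner_self_eq_norm_sq, h₁, h₂, h₁₂,
    real_inner_comm, h₁₂]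
  simp

/-! ### Pointwise identities from complex geometric optics solutions -/

section

variable {n : ℕ} {Ω : Set (EuclideanSpace ℝ (Fin n))} {γ₀ : EuclideanSpace ℝ (Fin n) → ℝ}
  {β : EuclideanSpace ℝ (Fin n) → ℂ}

lemma expo_sum {ι : Type*} (s : Finset ι) (z : ι → Fin n → ℂ) (x : EuclideanSpace ℝ (Fin n)) :
    expo (∑ l ∈ s, z l) x = ∏ l ∈ s, expo (z l) x := by
  classical
  induction s using Finset.induction_on with
  | empty => simp
  | insert a s ha ih => rw [Finset.sum_insert ha, Finset.prod_insert ha, expo_add, ih]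

/-- Each derivative of `exp (i (N + 1) z · x) A` brings down a factor `N + 1`; the derivative of `A`
is of lower order. Splitting off the growing scalar leaves vector fields with a bounded limit. The
parameter is `N + 1` so that it never vanishes. -/
lemma exists_cgo_factored (hΩ : IsOpen Ω) (hΩb : Bornology.IsBounded Ω)
    (hβ : ContDiff ℝ ∞ β) (hβ0 : ∀ x, β x ≠ 0) (hγ : ∀ x ∈ closure Ω, (γ₀ x : ℂ) = β x ^ 2)
    {z η : Fin n → ℂ} (hz : IsNullDir z) (hη : bdot z η = 0) :
    ∃ (u : ℕ → EuclideanSpace ℝ (Fin n) → ℂ) (B : ℕ → Fin n → EuclideanSpace ℝ (Fin n) → ℂ),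
      (∀ N, IsSmoothSolution Ω γ₀ (u N)) ∧
      (∀ N i x, partialD i (u N) x
        = (((N : ℂ) + 1) * expo (((N : ℂ) + 1) • z) x) * B N i x) ∧
      (∀ N i, Continuous (B N i)) ∧ (∃ C, ∀ N i, ∀ x ∈ Ω, ‖B N i x‖ ≤ C) ∧
      ∀ i, ∀ x ∈ Ω, Tendsto (fun N => B N i x) atTop
        (𝓝 (Complex.I * z i * ((β x)⁻¹ * expo η x))) := by
  obtain ⟨hnull, e, t, he, ht, him⟩ := hz
  have hτ : Tendsto (fun N : ℕ => ((N : ℝ) + 1) * t) atTop atTop :=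
    (tendsto_atTop_add_const_right _ _ tendsto_natCast_atTop_atTop).atTop_mul_const ht
  obtain ⟨A, hA1, hA2, ⟨C, hC⟩, hA4⟩ := exists_cgo_seq hΩ hΩb hβ hβ0 hγ he η
    (ζ := fun N => ((N : ℂ) + 1) • z) hτ
    (fun N j => by simp [him]; ring)
    (fun N => by
      have : bdot (((N : ℂ) + 1) • z) (((N : ℂ) + 1) • z) = 0 := by
        rw [bdot_smul_left, bdot_smul_right, hnull]; simp
      simpa [bdot, pow_two] using this)
    (fun N => by
      have : bdot (((N : ℂ) + 1) • z) η = 0 := by rw [bdot_smul_left, hη]; simp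
      simpa [bdot] using this)
  have hN0 : ∀ N : ℕ, (N : ℂ) + 1 ≠ 0 := fun N => Nat.cast_add_one_ne_zero N
  refine ⟨_, fun N i x => Complex.I * z i * A N x + ((N : ℂ) + 1)⁻¹ * partialD i (A N) x, hA2,
    fun N i x => ?_, fun N i => ?_, ⟨(∑ i, ‖z i‖) * C + C, fun N i x hx => ?_⟩, fun i x hx => ?_⟩
  · rw [partialD_expo_mul _ _ ((hA1 N).differentiable (by simp) x)]
    have := hN0 N
    simp only [Pi.smul_apply, smul_eq_mul]
    field_simp
  · exact (continuous_const.mul (hA1 N).continuous).add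
      (continuous_const.mul (contDiff_partialD (hA1 N) i).continuous)
  · obtain ⟨h1, h2⟩ := hC N x hx
    have hC0 : 0 ≤ C := (norm_nonneg _).trans h1
    have h3 : ‖((N : ℂ) + 1)⁻¹‖ ≤ 1 := by
      have : ((N : ℂ) + 1) = ((N + 1 : ℕ) : ℂ) := by push_cast; rfl
      rw [this, norm_inv, Complex.norm_natCast]
      exact inv_le_one_of_one_le₀ (by simp)
    refine (norm_add_le _ _).trans (add_le_add ?_ ?_)
    · rw [norm_mul, norm_mul, Complex.norm_I, one_mul]
      exact mul_le_mul (Finset.single_le_sum (f := fun i => ‖z i‖) (fun _ _ => norm_nonneg _)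
        (Finset.mem_univ i)) h1 (norm_nonneg _) (Finset.sum_nonneg fun _ _ => norm_nonneg _)
    · rw [norm_mul]
      calc _ ≤ 1 * C := mul_le_mul h3 (h2 i) (norm_nonneg _) zero_le_one
        _ = C := one_mul C
  · obtain ⟨h1, h2⟩ := hA4 x hx
    have h3 : Tendsto (fun N : ℕ => ((N : ℂ) + 1)⁻¹) atTop (𝓝 0) := by
      simpa using tendsto_one_div_add_atTop_nhds_zero_nat (𝕜 := ℂ)
    have h4 := (h1.const_mul (Complex.I * z i)).add (h3.mul (h2 i))
    simpa using h4

variable {m : ℕ} {T : EuclideanSpace ℝ (Fin n) → (Fin m → Fin n) → ℂ}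

/-- Leading order of the integral identity for complex geometric optics solutions whose null
directions add up to zero. -/
lemma integral_contr_eq_zero (hΩ : IsOpen Ω) (hΩb : Bornology.IsBounded Ω)
    (hβ : ContDiff ℝ ∞ β) (hβ0 : ∀ x, β x ≠ 0) (hγ : ∀ x ∈ closure Ω, (γ₀ x : ℂ) = β x ^ 2)
    (hTc : ContinuousOn T (closure Ω))
    (hT : ∀ u : Fin (m + 2) → EuclideanSpace ℝ (Fin n) → ℂ,
      (∀ l, IsSmoothSolution Ω γ₀ (u l)) →
      ∑ l : Equiv.Perm (Fin (m + 1)), ∑ j : Fin m → Fin n,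
        ∫ x in Ω, T x j
          * (∏ k : Fin m, partialD (j k) (u (l k.castSucc).castSucc) x)
          * gradDot (u (l (Fin.last m)).castSucc) (u (Fin.last (m + 1))) x = 0)
    {z η : Fin (m + 2) → Fin n → ℂ} (hz : ∀ l, IsNullDir (z l)) (hη : ∀ l, bdot (z l) (η l) = 0)
    (hsum : ∑ l, z l = 0) :
    ∫ x in Ω, ((∑ l : Equiv.Perm (Fin (m + 1)),
        contr (T x) (fun k => z (l k.castSucc).castSucc)
          * bdot (z (l (Fin.last m)).castSucc) (z (Fin.last (m + 1)))) * (β x)⁻¹ ^ (m + 2))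
        * expo (∑ l, η l) x = 0 := by
  choose u B hu hfac hBc hBb hB using fun l => exists_cgo_factored hΩ hΩb hβ hβ0 hγ (hz l) (hη l)
  choose C hC using hBb
  have hlim := integral_identity_limit hΩ hΩb hTc hT (u := fun N l => u l N) (fun N l => hu l N)
    (g := fun N l x => ((N : ℂ) + 1) * expo (((N : ℂ) + 1) • z l) x) (B := fun N l => B l N)
    (B' := fun l i x => Complex.I * z l i * ((β x)⁻¹ * expo (η l) x))
    (κ := fun N => ((N : ℂ) + 1) ^ (m + 2))
    (fun N => pow_ne_zero _ (Nat.cast_add_one_ne_zero N)) (fun N l i x _ => hfac l N i x)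
    (fun N x _ => by
      rw [Finset.prod_mul_distrib, ← expo_sum, ← Finset.smul_sum, hsum, smul_zero]
      simp)
    (fun N l i => (hBc l N i).continuousOn)
    ⟨∑ l, |C l|, fun N l i x hx => (hC l N i x hx).trans ((le_abs_self _).trans
      (Finset.single_le_sum (f := fun l => |C l|) (fun _ _ => abs_nonneg _)
        (Finset.mem_univ l)))⟩
    (fun l i x hx => hB l i x hx)
  have hterm : ∀ (l : Equiv.Perm (Fin (m + 1))) (j : Fin m → Fin n) x,
      T x j * (∏ k : Fin m, Complex.I * z (l k.castSucc).castSucc (j k)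
          * ((β x)⁻¹ * expo (η (l k.castSucc).castSucc) x))
        * ∑ i, Complex.I * z (l (Fin.last m)).castSucc i
            * ((β x)⁻¹ * expo (η (l (Fin.last m)).castSucc) x)
          * (Complex.I * z (Fin.last (m + 1)) i * ((β x)⁻¹ * expo (η (Fin.last (m + 1))) x))
      = Complex.I ^ (m + 2) * ((T x j * (∏ k : Fin m, z (l k.castSucc).castSucc (j k))
          * bdot (z (l (Fin.last m)).castSucc) (z (Fin.last (m + 1)))) * (β x)⁻¹ ^ (m + 2)
        * expo (∑ l, η l) x) := by
    intro l j x
    rw [expo_sum, ← prod_castSucc_perm (fun k => expo (η k) x) l, Finset.prod_mul_distrib,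
      Finset.prod_mul_distrib, Finset.prod_mul_distrib, bdot, Finset.mul_sum, Finset.mul_sum,
      Finset.sum_mul, Finset.sum_mul, Finset.mul_sum]
    refine Finset.sum_congr rfl fun i _ => ?_
    simp only [Finset.prod_const, Finset.card_univ, Fintype.card_fin]
    ring
  simp_rw [hterm, integral_const_mul, ← Finset.mul_sum] at hlim
  have h0 := (mul_eq_zero.1 hlim).resolve_left (pow_ne_zero _ Complex.I_ne_zero)
  have hβc : Continuous fun x => (β x)⁻¹ := (hβ.inv hβ0).continuous
  have hInt : ∀ (l : Equiv.Perm (Fin (m + 1))) (j : Fin m → Fin n),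
      IntegrableOn (fun x => (T x j * (∏ k : Fin m, z (l k.castSucc).castSucc (j k))
          * bdot (z (l (Fin.last m)).castSucc) (z (Fin.last (m + 1)))) * (β x)⁻¹ ^ (m + 2)
        * expo (∑ l, η l) x) Ω := fun l j =>
    integrableOn_of_continuousOn_closure hΩb <|
      ((((continuousOn_pi.1 hTc j).mul continuousOn_const).mul continuousOn_const).mul
        (hβc.pow _).continuousOn).mul (contDiff_expo _).continuous.continuousOn
  rw [← h0]
  simp_rw [← integral_finsetSum _ fun j _ => hInt _ j]
  rw [← integral_finsetSum _ fun l _ => integrable_finsetSum _ fun j _ => hInt l j]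
  refine integral_congr_ae (Eventually.of_forall fun x => ?_)
  simp only [contr_apply, Finset.sum_mul]

end

/-! ### Tensors of rank at least two -/

section

variable {n : ℕ} {Ω : Set (EuclideanSpace ℝ (Fin n))} {γ₀ : EuclideanSpace ℝ (Fin n) → ℝ}
  {β : EuclideanSpace ℝ (Fin n) → ℂ} {m : ℕ} {T : EuclideanSpace ℝ (Fin n) → (Fin m → Fin n) → ℂ}

/-- Two non-orthogonal null directions give enough freedom in the amplitudes `η l` for their sum to
be an arbitrary real frequency, so Fourier uniqueness localizes the leading-order integral identity.
-/
lemma sum_contr_mul_bdot_eq_zero (hΩ : IsOpen Ω) (hΩb : Bornology.IsBounded Ω)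
    (hβ : ContDiff ℝ ∞ β) (hβ0 : ∀ x, β x ≠ 0) (hγ : ∀ x ∈ closure Ω, (γ₀ x : ℂ) = β x ^ 2)
    (hTc : ContinuousOn T (closure Ω))
    (hT : ∀ u : Fin (m + 2) → EuclideanSpace ℝ (Fin n) → ℂ,
      (∀ l, IsSmoothSolution Ω γ₀ (u l)) →
      ∑ l : Equiv.Perm (Fin (m + 1)), ∑ j : Fin m → Fin n,
        ∫ x in Ω, T x j
          * (∏ k : Fin m, partialD (j k) (u (l k.castSucc).castSucc) x)
          * gradDot (u (l (Fin.last m)).castSucc) (u (Fin.last (m + 1))) x = 0)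
    {z : Fin (m + 2) → Fin n → ℂ} (hz : ∀ l, IsNullDir (z l)) (hsum : ∑ l, z l = 0)
    {l₁ l₂ : Fin (m + 2)} (h₁₂ : bdot (z l₁) (z l₂) ≠ 0) {x : EuclideanSpace ℝ (Fin n)}
    (hx : x ∈ Ω) :
    ∑ l : Equiv.Perm (Fin (m + 1)), contr (T x) (fun k => z (l k.castSucc).castSucc)
      * bdot (z (l (Fin.last m)).castSucc) (z (Fin.last (m + 1))) = 0 := by
  have hne : l₁ ≠ l₂ := by
    rintro rfl
    exact h₁₂ (hz l₁).1
  have hβc : Continuous fun x => (β x)⁻¹ := (hβ.inv hβ0).continuous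
  have key := eq_zero_of_fourier_eq_zero hΩ hΩb
    (f := fun x => (∑ l : Equiv.Perm (Fin (m + 1)),
        contr (T x) (fun k => z (l k.castSucc).castSucc)
          * bdot (z (l (Fin.last m)).castSucc) (z (Fin.last (m + 1)))) * (β x)⁻¹ ^ (m + 2))
    (by
      refine (continuousOn_finsetSum _ fun l _ => ?_).mul (hβc.pow _).continuousOn
      simp_rw [contr_apply]
      exact (continuousOn_finsetSum _ fun j _ =>
        (continuousOn_pi.1 hTc j).mul continuousOn_const).mul continuousOn_const)
    (fun ξ => by
      -- The value of `s` makes `ξ - s z_l₂` orthogonal to `z_l₁`; the compensating amplitude `s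
      -- z_l₂` is orthogonal to `z_l₂` because that vector is null.
      set s := bdot (z l₁) (cvec ξ) / bdot (z l₁) (z l₂) with hs
      let η : Fin (m + 2) → Fin n → ℂ :=
        Pi.single l₁ (cvec ξ - s • z l₂) + Pi.single l₂ (s • z l₂)
      have hη : ∀ l, bdot (z l) (η l) = 0 := by
        intro l
        by_cases h1 : l = l₁
        · subst h1
          simp only [η, Pi.add_apply, Pi.single_eq_same, Pi.single_eq_of_ne hne, add_zero]
          rw [bdot_sub_right, bdot_smul_right, hs, div_mul_cancel₀ _ h₁₂, sub_self]
        · by_cases h2 : l = l₂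
          · subst h2
            simp only [η, Pi.add_apply, Pi.single_eq_same, Pi.single_eq_of_ne h1, zero_add]
            rw [bdot_smul_right, (hz l).1, mul_zero]
          · simp [η, Pi.single_eq_of_ne h1, Pi.single_eq_of_ne h2]
      have hηs : ∑ l, η l = cvec ξ := by
        simp [η, Finset.sum_add_distrib]
      have := integral_contr_eq_zero hΩ hΩb hβ hβ0 hγ hTc hT hz hη hsum
      rwa [hηs] at this) x hx
  exact (mul_eq_zero.1 key).resolve_right (pow_ne_zero _ (inv_ne_zero (hβ0 x)))

lemma exists_perm_castSucc {m : ℕ} {l : Equiv.Perm (Fin (m + 1))} (h : l (Fin.last m) = Fin.last m) :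
    ∃ σ : Equiv.Perm (Fin m), ∀ k, (σ k).castSucc = l k.castSucc := by
  have hne : ∀ k : Fin m, l k.castSucc ≠ Fin.last m := fun k hk => by
    rw [← h] at hk
    exact (Fin.castSucc_lt_last k).ne (l.injective hk)
  let f : Fin m → Fin m := fun k => (l k.castSucc).castPred (hne k)
  have hf : Function.Injective f := fun k k' hkk => by
    have := congrArg Fin.castSucc hkk
    simp only [f, Fin.castSucc_castPred] at this
    exact Fin.castSucc_injective _ (l.injective this)
  exact ⟨Equiv.ofBijective f (Finite.injective_iff_bijective.1 hf), fun k => by simp [f]⟩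

/-- A colouring of `m + 1` points, permuted so that the last point keeps its colour, restricts on
the first `m` points to a permutation of the original colouring. -/
lemma exists_perm_of_color_last {m : ℕ} {α : Type*} (c : Fin (m + 1) → α)
    (l : Equiv.Perm (Fin (m + 1))) (h : c (l (Fin.last m)) = c (Fin.last m)) :
    ∃ σ : Equiv.Perm (Fin m), ∀ k : Fin m, c (l k.castSucc) = c (σ k).castSucc := by
  let s := Equiv.swap (l (Fin.last m)) (Fin.last m)
  have hs : ∀ y, c (s y) = c y := by
    intro y
    by_cases h1 : y = l (Fin.last m)
    · subst h1; simp [s, h]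
    · by_cases h2 : y = Fin.last m
      · subst h2; simp [s, h]
      · simp only [s, Equiv.swap_apply_of_ne_of_ne h1 h2]
  obtain ⟨σ, hσ⟩ := exists_perm_castSucc (l := l.trans s) (by simp [s])
  refine ⟨σ, fun k => ?_⟩
  rw [hσ k, Equiv.trans_apply, hs]

/-- Mixed contractions with two non-orthogonal null vectors vanish. -/
lemma contr_mixed_eq_zero (hΩ : IsOpen Ω) (hΩb : Bornology.IsBounded Ω)
    (hβ : ContDiff ℝ ∞ β) (hβ0 : ∀ x, β x ≠ 0) (hγ : ∀ x ∈ closure Ω, (γ₀ x : ℂ) = β x ^ 2)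
    (hTc : ContinuousOn T (closure Ω)) (hTs : ∀ x ∈ closure Ω, IsSymmTensor (T x))
    (hT : ∀ u : Fin (m + 2) → EuclideanSpace ℝ (Fin n) → ℂ,
      (∀ l, IsSmoothSolution Ω γ₀ (u l)) →
      ∑ l : Equiv.Perm (Fin (m + 1)), ∑ j : Fin m → Fin n,
        ∫ x in Ω, T x j
          * (∏ k : Fin m, partialD (j k) (u (l k.castSucc).castSucc) x)
          * gradDot (u (l (Fin.last m)).castSucc) (u (Fin.last (m + 1))) x = 0)
    {ζ θ : Fin n → ℂ} (hζ : IsNullDir ζ) (hθ : IsNullDir θ) (hζθ : bdot ζ θ ≠ 0)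
    {s : Finset (Fin m)} (hs : s.Nonempty) (hs' : sᶜ.Nonempty) {x : EuclideanSpace ℝ (Fin n)}
    (hx : x ∈ Ω) : contr (T x) (s.piecewise (fun _ => ζ) fun _ => θ) = 0 := by
  have ha : (s.card : ℝ) ≠ 0 := by exact_mod_cast hs.card_pos.ne'
  have hb : (sᶜ.card : ℝ) ≠ 0 := by exact_mod_cast hs'.card_pos.ne'
  -- Directions are colours: the first `m` follow `s`, the next is `ζ`, and the last solution gets
  -- `θ`. The scalars `-s.card` and `-sᶜ.card` on the final two make the exponents sum to zero; they
  -- are nonzero because both `s` and its complement are nonempty.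
  let dir : Fin (m + 1) → Fin n → ℂ :=
    Fin.snoc (α := fun _ => Fin n → ℂ) (s.piecewise (fun _ => ζ) fun _ => θ) ζ
  let a : Fin (m + 1) → ℝ := Fin.snoc (α := fun _ => ℝ) (fun _ => 1) (-(s.card : ℝ))
  have ha0 : ∀ k, a k ≠ 0 := by
    intro k
    induction k using Fin.lastCases with
    | last => simpa [a] using ha
    | cast k => simp [a]
  have hdir : ∀ k, dir k = ζ ∨ dir k = θ := by
    intro k
    induction k using Fin.lastCases with
    | last => simp [dir]
    | cast k => by_cases hk : k ∈ s <;> simp [dir, hk]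
  have hdirn : ∀ k, IsNullDir (dir k) := fun k => by
    rcases hdir k with h | h <;> rw [h] <;> assumption
  let z : Fin (m + 2) → Fin n → ℂ := Fin.snoc (α := fun _ => Fin n → ℂ)
    (fun k => (a k : ℂ) • dir k) (((-(sᶜ.card : ℝ) : ℝ) : ℂ) • θ)
  have hzc : ∀ k : Fin (m + 1), z k.castSucc = (a k : ℂ) • dir k := fun k => by simp [z]
  have hzl : z (Fin.last (m + 1)) = ((-(sᶜ.card : ℝ) : ℝ) : ℂ) • θ := by simp [z]
  have hz : ∀ l, IsNullDir (z l) := by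
    intro l
    induction l using Fin.lastCases with
    | last => rw [hzl]; exact hθ.smul (neg_ne_zero.2 hb)
    | cast k => rw [hzc]; exact (hdirn k).smul (ha0 k)
  have hsum : ∑ l, z l = 0 := by
    rw [Fin.sum_univ_castSucc, Fin.sum_univ_castSucc, hzl]
    simp only [hzc, a, dir, Fin.snoc_castSucc, Fin.snoc_last, Complex.ofReal_one, one_smul]
    have h1 : ∑ k, (s.piecewise (fun _ => ζ) fun _ => θ) k
        = (s.card : ℂ) • ζ + (sᶜ.card : ℂ) • θ := by
      rw [← Finset.sum_add_sum_compl s]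
      congr 1
      · rw [Finset.sum_congr rfl (g := fun _ => ζ) fun k hk =>
          Finset.piecewise_eq_of_mem s _ _ hk]
        simp [Nat.cast_smul_eq_nsmul]
      · rw [Finset.sum_congr rfl (g := fun _ => θ) fun k hk =>
          Finset.piecewise_eq_of_notMem s _ _ (Finset.mem_compl.1 hk)]
        simp [Nat.cast_smul_eq_nsmul]
    rw [h1]
    push_cast
    module
  have hlast : dir (Fin.last m) = ζ := by simp [dir]
  have h₁₂ : bdot (z (Fin.last m).castSucc) (z (Fin.last (m + 1))) ≠ 0 := by
    rw [hzc, hzl, hlast, bdot_smul_left, bdot_smul_right]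
    exact mul_ne_zero (by exact_mod_cast ha0 _)
      (mul_ne_zero (by exact_mod_cast neg_ne_zero.2 hb) hζθ)
  have key := sum_contr_mul_bdot_eq_zero hΩ hΩb hβ hβ0 hγ hTc hT hz hsum h₁₂ hx
  set P : ℂ := (∏ k, (a k : ℂ)) * ((-(sᶜ.card : ℝ) : ℝ) : ℂ) * bdot ζ θ with hP
  have hP0 : P ≠ 0 := by
    refine mul_ne_zero (mul_ne_zero (Finset.prod_ne_zero_iff.2 fun k _ => ?_) ?_) hζθ
    · exact_mod_cast ha0 k
    · exact_mod_cast neg_ne_zero.2 hb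
  classical
  -- If the solution paired with the last one has direction `θ`, the pairing is a multiple of `θ · θ
  -- = 0`. Otherwise the remaining colours are a rearrangement of the original ones, and symmetry of
  -- `T x` makes all these terms equal.
  have hterm : ∀ l : Equiv.Perm (Fin (m + 1)),
      contr (T x) (fun k => z (l k.castSucc).castSucc)
        * bdot (z (l (Fin.last m)).castSucc) (z (Fin.last (m + 1)))
      = if dir (l (Fin.last m)) = ζ then
          P * contr (T x) (s.piecewise (fun _ => ζ) fun _ => θ) else 0 := by
    intro l
    simp only [hzc, hzl, bdot_smul_left, bdot_smul_right]
    split_ifs with h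
    · obtain ⟨σ, hσ⟩ := exists_perm_of_color_last dir l (by rw [h, hlast])
      have h1 : contr (T x) (fun k : Fin m => dir (l k.castSucc))
          = contr (T x) (s.piecewise (fun _ => ζ) fun _ => θ) := by
        rw [← contr_comp_perm (hTs x (subset_closure hx)) (s.piecewise _ _) σ]
        congr 1
        funext k
        rw [hσ k]
        simp [dir]
      rw [MultilinearMap.map_smul_univ, h1, h, hP, ← Equiv.prod_comp l, Fin.prod_univ_castSucc,
        smul_eq_mul]
      ring
    · rw [(hdir _).resolve_left h, hθ.1]
      simp
  simp_rw [hterm] at key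
  rw [← Finset.sum_filter, Finset.sum_const, smul_eq_zero] at key
  rcases key with h | h
  · have : (1 : Equiv.Perm (Fin (m + 1))) ∈
        Finset.univ.filter fun l : Equiv.Perm (Fin (m + 1)) => dir (l (Fin.last m)) = ζ := by
      simp [hlast]
    rw [Finset.card_eq_zero.1 h] at this
    simp at this
  · exact (mul_eq_zero.1 h).resolve_left hP0

lemma exists_orthonormal_triple (hn : 3 ≤ n) {e₁ : EuclideanSpace ℝ (Fin n)} (he : ‖e₁‖ = 1) :
    ∃ e₂ e₃ : EuclideanSpace ℝ (Fin n), ‖e₂‖ = 1 ∧ ‖e₃‖ = 1 ∧ inner ℝ e₁ e₂ = 0 ∧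
      inner ℝ e₁ e₃ = 0 ∧ inner ℝ e₂ e₃ = 0 := by
  obtain ⟨b, hb⟩ := exists_orthonormalBasis_apply_eq (⟨0, by omega⟩ : Fin n) he
  refine ⟨b ⟨1, by omega⟩, b ⟨2, by omega⟩, b.norm_eq_one _, b.norm_eq_one _, ?_, ?_, ?_⟩
  · rw [← hb]; exact b.orthonormal.2 (by simp)
  · rw [← hb]; exact b.orthonormal.2 (by simp)
  · exact b.orthonormal.2 (by simp)

/-- Vanishing of `T` for rank at least two. -/
lemma eq_zero_of_two_le_rank (hn : 3 ≤ n) (hm : 2 ≤ m) (hΩ : IsOpen Ω)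
    (hΩb : Bornology.IsBounded Ω)
    (hβ : ContDiff ℝ ∞ β) (hβ0 : ∀ x, β x ≠ 0) (hγ : ∀ x ∈ closure Ω, (γ₀ x : ℂ) = β x ^ 2)
    (hTc : ContinuousOn T (closure Ω)) (hTs : ∀ x ∈ closure Ω, IsSymmTensor (T x))
    (hT : ∀ u : Fin (m + 2) → EuclideanSpace ℝ (Fin n) → ℂ,
      (∀ l, IsSmoothSolution Ω γ₀ (u l)) →
      ∑ l : Equiv.Perm (Fin (m + 1)), ∑ j : Fin m → Fin n,
        ∫ x in Ω, T x j
          * (∏ k : Fin m, partialD (j k) (u (l k.castSucc).castSucc) x)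
          * gradDot (u (l (Fin.last m)).castSucc) (u (Fin.last (m + 1))) x = 0)
    {x : EuclideanSpace ℝ (Fin n)} (hx : x ∈ Ω) : T x = 0 := by
  have hmix : ∀ {ζ θ : Fin n → ℂ}, IsNullDir ζ → IsNullDir θ → bdot ζ θ ≠ 0 →
      ∀ {s : Finset (Fin m)}, s.Nonempty → sᶜ.Nonempty →
        contr (T x) (s.piecewise (fun _ => ζ) fun _ => θ) = 0 := fun hζ hθ hζθ _ hs hs' =>
    contr_mixed_eq_zero hΩ hΩb hβ hβ0 hγ hTc hTs hT hζ hθ hζθ hs hs' hx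
  let k₀ : Fin m := ⟨0, by omega⟩
  let k₁ : Fin m := ⟨1, by omega⟩
  have hk : k₁ ≠ k₀ := by simp [k₀, k₁]
  -- pure powers of a null vector
  have hpure : ∀ {e₁ e₂ e₃ : EuclideanSpace ℝ (Fin n)}, ‖e₁‖ = 1 → ‖e₂‖ = 1 → ‖e₃‖ = 1 →
      inner ℝ e₁ e₂ = 0 → inner ℝ e₁ e₃ = 0 → inner ℝ e₂ e₃ = 0 →
      contr (T x) (fun _ => nullv e₁ e₂) = 0 := by
    intro e₁ e₂ e₃ h₁ h₂ h₃ h₁₂ h₁₃ h₂₃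
    have hζ := isNullDir_nullv h₁ h₂ h₁₂
    -- Replacing a single slot still leaves a slot with the original vector because `m ≥ 2`, so the
    -- mixed vanishing applies.
    have hslot : ∀ θ, IsNullDir θ → bdot (nullv e₁ e₂) θ ≠ 0 →
        contr (T x) (Function.update (fun _ => nullv e₁ e₂) k₀ θ) = 0 := by
      intro θ hθ hne
      have := hmix hζ hθ hne (s := {k₀}ᶜ) ⟨k₁, by simp [hk]⟩ ⟨k₀, by simp⟩
      rw [← this]
      congr 1
      funext k
      by_cases h : k = k₀
      · subst h; simp
      · simp [h]
    have h₂₁ : inner ℝ e₂ e₁ = 0 := by rw [real_inner_comm]; exact h₁₂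
    have h₁0 : e₁ ≠ 0 := norm_ne_zero_iff.1 (by simp [h₁])
    have h₂0 : e₂ ≠ 0 := norm_ne_zero_iff.1 (by simp [h₂])
    have g1 := hslot (nullv e₁ e₃) (isNullDir_nullv h₁ h₃ h₁₃)
      (by rw [bdot_nullv]; simp [h₁₃, h₂₃, h₂₁, h₁0])
    have g2 := hslot (nullv e₁ (-e₃)) (isNullDir_nullv h₁ (by simpa using h₃) (by simpa using h₁₃))
      (by rw [bdot_nullv]; simp [h₁₃, h₂₃, h₂₁, h₁0])
    have g3 := hslot (nullv e₂ e₃) (isNullDir_nullv h₂ h₃ h₂₃)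
      (by rw [bdot_nullv]; simp [h₁₃, h₂₃, h₁₂, h₂0])
    have g4 := hslot (nullv e₂ (-e₃)) (isNullDir_nullv h₂ (by simpa using h₃) (by simpa using h₂₃))
      (by rw [bdot_nullv]; simp [h₁₃, h₂₃, h₁₂, h₂0])
    -- The vector `e₁ + i e₂` is a combination of the null vectors `e₁ ± i e₃` and `e₂ ± i e₃`,
    -- whose products with it are `1` and `i`. This needs a third dimension.
    have hdec : nullv e₁ e₂ = (1 / 2 : ℂ) • (nullv e₁ e₃ + nullv e₁ (-e₃))
        + (Complex.I / 2) • (nullv e₂ e₃ + nullv e₂ (-e₃)) := by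
      funext j
      simp [nullv]
      ring
    have : (fun _ : Fin m => nullv e₁ e₂)
        = Function.update (fun _ => nullv e₁ e₂) k₀ (nullv e₁ e₂) := by simp
    rw [this]
    nth_rewrite 2 [hdec]
    simp only [MultilinearMap.map_update_add, MultilinearMap.map_update_smul, g1, g2, g3, g4]
    simp
  have hunit : ∀ e₁ : EuclideanSpace ℝ (Fin n), ‖e₁‖ = 1 → contr (T x) (fun _ => cvec e₁) = 0 := by
    intro e₁ h₁
    obtain ⟨e₂, e₃, h₂, h₃, h₁₂, h₁₃, h₂₃⟩ := exists_orthonormal_triple hn h₁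
    have hζ := isNullDir_nullv h₁ h₂ h₁₂
    have h₂' : ‖-e₂‖ = 1 := by simpa using h₂
    have h₁₂' : inner ℝ e₁ (-e₂) = 0 := by simpa using h₁₂
    have h₂₃' : inner ℝ (-e₂) e₃ = 0 := by simpa using h₂₃
    have hθ := isNullDir_nullv h₁ h₂' h₁₂'
    have hne : bdot (nullv e₁ e₂) (nullv e₁ (-e₂)) ≠ 0 := by
      have h₂₁ : inner ℝ e₂ e₁ = 0 := by rw [real_inner_comm]; exact h₁₂
      rw [bdot_nullv]
      simp [h₁₂, h₂₁, h₁, h₂]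
    -- In the multilinear expansion of `(ζ + conj ζ)^m` the two extreme terms are pure powers and
    -- all others are mixed.
    have h2 : contr (T x) ((fun _ => nullv e₁ e₂) + fun _ => nullv e₁ (-e₂)) = 0 := by
      rw [MultilinearMap.map_add_univ]
      refine Finset.sum_eq_zero fun s _ => ?_
      rcases s.eq_empty_or_nonempty with rfl | hs
      · rw [Finset.piecewise_empty]
        exact hpure h₁ h₂' h₃ h₁₂' h₁₃ h₂₃'
      · rcases sᶜ.eq_empty_or_nonempty with h | hs'
        · rw [Finset.compl_eq_empty_iff] at h
          rw [h, Finset.piecewise_univ]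
          exact hpure h₁ h₂ h₃ h₁₂ h₁₃ h₂₃
        · exact hmix hζ hθ hne hs hs'
    have h3 : ((fun _ => nullv e₁ e₂) + fun _ => nullv e₁ (-e₂) : Fin m → Fin n → ℂ)
        = fun _ => (2 : ℂ) • cvec e₁ := by
      funext k j
      simp [nullv]
      ring
    rw [h3, MultilinearMap.map_smul_univ] at h2
    simpa using h2
  exact eq_zero_of_contr_unit_diag_eq_zero (by omega) (hTs x (subset_closure hx)) hunit

end

/-! ### Tensors of rank one -/

section

variable {n : ℕ} {Ω : Set (EuclideanSpace ℝ (Fin n))} {γ₀ : EuclideanSpace ℝ (Fin n) → ℝ}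
  {β : EuclideanSpace ℝ (Fin n) → ℂ} {T : EuclideanSpace ℝ (Fin n) → (Fin 1 → Fin n) → ℂ}

lemma continuousOn_contr {m : ℕ} {T : EuclideanSpace ℝ (Fin n) → (Fin m → Fin n) → ℂ}
    {s : Set (EuclideanSpace ℝ (Fin n))} (hTc : ContinuousOn T s) (Z : Fin m → Fin n → ℂ) :
    ContinuousOn (fun x => contr (T x) Z) s := by
  simp_rw [contr_apply]
  exact continuousOn_finsetSum _ fun j _ => (continuousOn_pi.1 hTc j).mul continuousOn_const

/-- The derivative `z · ∇u`. -/
def dirD (z : Fin n → ℂ) (u : EuclideanSpace ℝ (Fin n) → ℂ) (x : EuclideanSpace ℝ (Fin n)) : ℂ :=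
  ∑ i, z i * partialD i u x

lemma continuous_dirD (z : Fin n → ℂ) {u : EuclideanSpace ℝ (Fin n) → ℂ} (hu : ContDiff ℝ ∞ u) :
    Continuous (dirD z u) :=
  continuous_finsetSum _ fun i _ => continuous_const.mul (contDiff_partialD hu i).continuous

lemma dirD_mul (z : Fin n → ℂ) {u v : EuclideanSpace ℝ (Fin n) → ℂ} (hu : ContDiff ℝ ∞ u)
    (hv : ContDiff ℝ ∞ v) (x : EuclideanSpace ℝ (Fin n)) :
    dirD z (fun y => u y * v y) x = dirD z u x * v x + u x * dirD z v x := by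
  simp only [dirD]
  rw [Finset.sum_mul, Finset.mul_sum, ← Finset.sum_add_distrib]
  refine Finset.sum_congr rfl fun i _ => ?_
  rw [partialD_mul (hu.differentiable (by simp) x) (hv.differentiable (by simp) x)]
  ring

lemma dirD_expo (z ζ : Fin n → ℂ) (x : EuclideanSpace ℝ (Fin n)) :
    dirD z (expo ζ) x = Complex.I * bdot z ζ * expo ζ x := by
  simp only [dirD, partialD_expo, bdot, Finset.mul_sum, Finset.sum_mul]
  exact Finset.sum_congr rfl fun i _ => by ring

lemma dirD_smul (a : ℂ) (z : Fin n → ℂ) (u : EuclideanSpace ℝ (Fin n) → ℂ)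
    (x : EuclideanSpace ℝ (Fin n)) : dirD (a • z) u x = a * dirD z u x := by
  simp only [dirD, Finset.mul_sum, Pi.smul_apply, smul_eq_mul]
  exact Finset.sum_congr rfl fun i _ => by ring

/-- Two solutions go to infinity in opposite directions `z` and `-z`, so their exponentials cancel,
while `u₁` stays fixed. After division by `(N + 1) ^ 2` the term pairing the two large gradients
tends to a multiple of `z · z = 0`, and only the other permutation survives. -/
lemma integral_contr_mul_dirD_eq_zero (hΩ : IsOpen Ω) (hΩb : Bornology.IsBounded Ω)
    (hβ : ContDiff ℝ ∞ β) (hβ0 : ∀ x, β x ≠ 0) (hγ : ∀ x ∈ closure Ω, (γ₀ x : ℂ) = β x ^ 2)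
    (hTc : ContinuousOn T (closure Ω))
    (hT : ∀ u : Fin 3 → EuclideanSpace ℝ (Fin n) → ℂ,
      (∀ l, IsSmoothSolution Ω γ₀ (u l)) →
      ∑ l : Equiv.Perm (Fin 2), ∑ j : Fin 1 → Fin n,
        ∫ x in Ω, T x j
          * (∏ k : Fin 1, partialD (j k) (u (l k.castSucc).castSucc) x)
          * gradDot (u (l (Fin.last 1)).castSucc) (u (Fin.last 2)) x = 0)
    {z η : Fin n → ℂ} (hz : IsNullDir z) (hη : bdot z η = 0)
    {u₁ : EuclideanSpace ℝ (Fin n) → ℂ} (hu₁ : IsSmoothSolution Ω γ₀ u₁)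
    (hu₁s : ContDiff ℝ ∞ u₁) :
    ∫ x in Ω, contr (T x) (fun _ => z) * dirD z u₁ x * ((β x)⁻¹ ^ 2 * expo η x) = 0 := by
  have hz' : IsNullDir (((-1 : ℝ) : ℂ) • z) := hz.smul (by norm_num)
  obtain ⟨u, B, hu, hfac, hBc, ⟨C, hC⟩, hB⟩ := exists_cgo_factored hΩ hΩb hβ hβ0 hγ hz hη
  obtain ⟨v, B₁, hv, hfac₁, hBc₁, ⟨C₁, hC₁⟩, hB₁⟩ :=
    exists_cgo_factored hΩ hΩb hβ hβ0 hγ hz' (bdot_zero_right _)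
  obtain ⟨D, hD0, hD⟩ := exists_bound_of_isBounded hΩb hu₁s
  have hlim := integral_identity_limit hΩ hΩb hTc hT (u := fun N => ![u₁, u N, v N])
    (fun N l => by fin_cases l <;> simp [hu₁, hu, hv])
    (g := fun N => ![fun _ => 1, fun x => ((N : ℂ) + 1) * expo (((N : ℂ) + 1) • z) x,
      fun x => ((N : ℂ) + 1) * expo (((N : ℂ) + 1) • (((-1 : ℝ) : ℂ) • z)) x])
    (B := fun N => ![fun i => partialD i u₁, B N, B₁ N])
    (B' := ![fun i => partialD i u₁, fun i x => Complex.I * z i * ((β x)⁻¹ * expo η x),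
      fun i x => Complex.I * (((-1 : ℝ) : ℂ) • z) i * ((β x)⁻¹ * expo 0 x)])
    (κ := fun N => ((N : ℂ) + 1) ^ 2)
    (fun N => pow_ne_zero _ (Nat.cast_add_one_ne_zero N))
    (fun N l i x _ => by fin_cases l <;> simp [hfac, hfac₁])
    (fun N x _ => by
      have h1 : expo (((N : ℂ) + 1) • z) x * expo (((N : ℂ) + 1) • (((-1 : ℝ) : ℂ) • z)) x = 1 := by
        rw [← expo_add, ← smul_add]
        simp
      refine (Fin.prod_univ_three _).trans ?_
      change 1 * (((N : ℂ) + 1) * expo (((N : ℂ) + 1) • z) x)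
        * (((N : ℂ) + 1) * expo (((N : ℂ) + 1) • (((-1 : ℝ) : ℂ) • z)) x) = _
      linear_combination ((N : ℂ) + 1) ^ 2 * h1)
    (fun N l i => by
      fin_cases l
      · exact (contDiff_partialD hu₁s i).continuous.continuousOn
      · exact (hBc N i).continuousOn
      · exact (hBc₁ N i).continuousOn)
    ⟨max D (max C C₁), fun N l i x hx => by
      fin_cases l
      · exact ((hD x hx).2 i).trans (le_max_left _ _)
      · exact (hC N i x hx).trans ((le_max_left _ _).trans (le_max_right _ _))
      · exact (hC₁ N i x hx).trans ((le_max_right _ _).trans (le_max_right _ _))⟩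
    (fun l i x hx => by
      fin_cases l
      · exact tendsto_const_nhds
      · exact hB i x hx
      · exact hB₁ i x hx)
  have huniv : (Finset.univ : Finset (Equiv.Perm (Fin 2))) = {1, Equiv.swap 0 1} := by decide
  have h1 : ∀ (j : Fin 1 → Fin n) x, T x j * (∏ _k : Fin 1, partialD (j 0) u₁ x)
      * ∑ i, (Complex.I * z i * ((β x)⁻¹ * expo η x))
        * (Complex.I * (((-1 : ℝ) : ℂ) • z) i * ((β x)⁻¹ * expo 0 x)) = 0 := by
    intro j x
    have : ∑ i, (Complex.I * z i * ((β x)⁻¹ * expo η x))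
        * (Complex.I * (((-1 : ℝ) : ℂ) • z) i * ((β x)⁻¹ * expo 0 x))
        = (β x)⁻¹ ^ 2 * expo η x * bdot z z := by
      rw [bdot, Finset.mul_sum]
      refine Finset.sum_congr rfl fun i _ => ?_
      simp only [expo_zero, Pi.smul_apply, smul_eq_mul]
      push_cast
      linear_combination (-(z i * z i * (β x)⁻¹ ^ 2 * expo η x)) * Complex.I_sq
    rw [this, hz.1]
    ring
  have h2 : ∀ (j : Fin 1 → Fin n) x,
      T x j * (∏ _k : Fin 1, Complex.I * z (j 0) * ((β x)⁻¹ * expo η x))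
      * ∑ i, partialD i u₁ x * (Complex.I * (((-1 : ℝ) : ℂ) • z) i * ((β x)⁻¹ * expo 0 x))
      = T x j * z (j 0) * dirD z u₁ x * ((β x)⁻¹ ^ 2 * expo η x) := by
    intro j x
    simp only [dirD, Finset.mul_sum, Finset.sum_mul]
    refine Finset.sum_congr rfl fun i _ => ?_
    simp only [Finset.prod_const, Finset.card_univ, Fintype.card_fin, pow_one, expo_zero,
      Pi.smul_apply, smul_eq_mul]
    push_cast
    linear_combination (-(T x j * z (j 0) * z i * partialD i u₁ x * (β x)⁻¹ ^ 2 * expo η x))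
      * Complex.I_sq
  rw [huniv, Finset.sum_insert (by decide), Finset.sum_singleton] at hlim
  have hρ : Continuous fun x => (β x)⁻¹ := (hβ.inv hβ0).continuous
  have hInt : ∀ j : Fin 1 → Fin n, IntegrableOn
      (fun x => T x j * z (j 0) * dirD z u₁ x * ((β x)⁻¹ ^ 2 * expo η x)) Ω := fun j =>
    integrableOn_of_continuousOn_closure hΩb <|
      (((continuousOn_pi.1 hTc j).mul continuousOn_const).mul
        (continuous_dirD z hu₁s).continuousOn).mul
        ((hρ.pow 2).mul (contDiff_expo η).continuous).continuousOn
  have hA : ∑ j : Fin 1 → Fin n, ∫ x in Ω,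
      T x j * z (j 0) * dirD z u₁ x * ((β x)⁻¹ ^ 2 * expo η x) = 0 := by
    rw [← hlim]
    symm
    rw [add_eq_right.2]
    · refine Finset.sum_congr rfl fun j _ => integral_congr_ae (Eventually.of_forall fun x => ?_)
      beta_reduce
      rw [← h2 j x]
      congr 1
    · refine Finset.sum_eq_zero fun j _ => ?_
      refine (integral_congr_ae (g := fun _ => 0) (Eventually.of_forall fun x => ?_)).trans
        (integral_zero _ _)
      beta_reduce
      rw [← h1 j x]
      congr 1
  rw [← integral_finsetSum _ fun j _ => hInt j] at hA
  rw [← hA]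
  refine integral_congr_ae (Eventually.of_forall fun x => ?_)
  simp only [contr_apply, Finset.sum_mul, Fin.prod_univ_one]

end

/-! ### Rank one: the second limit, in the remaining solution. -/

section

variable {n : ℕ} {Ω : Set (EuclideanSpace ℝ (Fin n))} {γ₀ : EuclideanSpace ℝ (Fin n) → ℝ}
  {β : EuclideanSpace ℝ (Fin n) → ℂ} {T : EuclideanSpace ℝ (Fin n) → (Fin 1 → Fin n) → ℂ}

/-- Nullity is `(s - κ)² + 4 s κ = (s + κ)²`. The component along `e₃` absorbs the defect, so the
vector can grow with `s` while its product with `e₁ + i e₂` stays at `-2 κ`. -/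
lemma nullv_perturbed_null {e₁ e₂ e₃ : EuclideanSpace ℝ (Fin n)} (h₁ : ‖e₁‖ = 1) (h₂ : ‖e₂‖ = 1)
    (h₃ : ‖e₃‖ = 1) (h₁₂ : inner ℝ e₁ e₂ = 0) (h₁₃ : inner ℝ e₁ e₃ = 0)
    (h₂₃ : inner ℝ e₂ e₃ = 0) {s κ : ℝ} (hs : 0 ≤ s) (hκ : 0 ≤ κ) :
    bdot (nullv ((s - κ) • e₁ + (2 * Real.sqrt (s * κ)) • e₃) ((s + κ) • e₂))
        (nullv ((s - κ) • e₁ + (2 * Real.sqrt (s * κ)) • e₃) ((s + κ) • e₂)) = 0 ∧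
      bdot (nullv e₁ e₂) (nullv ((s - κ) • e₁ + (2 * Real.sqrt (s * κ)) • e₃) ((s + κ) • e₂))
        = ((-(2 * κ) : ℝ) : ℂ) := by
  have s₁ : inner ℝ e₁ e₁ = (1 : ℝ) := by rw [real_inner_self_eq_norm_sq, h₁, one_pow]
  have s₂ : inner ℝ e₂ e₂ = (1 : ℝ) := by rw [real_inner_self_eq_norm_sq, h₂, one_pow]
  have s₃ : inner ℝ e₃ e₃ = (1 : ℝ) := by rw [real_inner_self_eq_norm_sq, h₃, one_pow]
  have h₂₁ : inner ℝ e₂ e₁ = 0 := by rw [real_inner_comm]; exact h₁₂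
  have h₃₁ : inner ℝ e₃ e₁ = 0 := by rw [real_inner_comm]; exact h₁₃
  have h₃₂ : inner ℝ e₃ e₂ = 0 := by rw [real_inner_comm]; exact h₂₃
  have hq : Real.sqrt (s * κ) * Real.sqrt (s * κ) = s * κ :=
    Real.mul_self_sqrt (mul_nonneg hs hκ)
  constructor
  · rw [bdot_nullv]
    simp only [inner_add_left, inner_add_right, real_inner_smul_left, real_inner_smul_right,
      s₁, s₂, s₃, h₁₂, h₁₃, h₂₁, h₂₃, h₃₁, h₃₂]
    have hq' : (Real.sqrt (s * κ) : ℂ) * (Real.sqrt (s * κ) : ℂ) = s * κ := by exact_mod_cast hq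
    push_cast
    linear_combination 4 * hq'
  · rw [bdot_nullv]
    simp only [inner_add_right, real_inner_smul_right, s₁, s₂, h₁₂, h₁₃, h₂₁, h₂₃]
    push_cast
    ring

/-- The second limit, along null vectors that stay almost orthogonal to `e₁ + i e₂`. -/
lemma integral_contr_mul_dirD_inv_aux (hΩ : IsOpen Ω) (hΩb : Bornology.IsBounded Ω)
    (hβ : ContDiff ℝ ∞ β) (hβ0 : ∀ x, β x ≠ 0) (hγ : ∀ x ∈ closure Ω, (γ₀ x : ℂ) = β x ^ 2)
    (hTc : ContinuousOn T (closure Ω))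
    (hT : ∀ u : Fin 3 → EuclideanSpace ℝ (Fin n) → ℂ,
      (∀ l, IsSmoothSolution Ω γ₀ (u l)) →
      ∑ l : Equiv.Perm (Fin 2), ∑ j : Fin 1 → Fin n,
        ∫ x in Ω, T x j
          * (∏ k : Fin 1, partialD (j k) (u (l k.castSucc).castSucc) x)
          * gradDot (u (l (Fin.last 1)).castSucc) (u (Fin.last 2)) x = 0)
    {e₁ e₂ e₃ : EuclideanSpace ℝ (Fin n)} (h₁ : ‖e₁‖ = 1) (h₂ : ‖e₂‖ = 1)
    (h₃ : ‖e₃‖ = 1) (h₁₂ : inner ℝ e₁ e₂ = 0) (h₁₃ : inner ℝ e₁ e₃ = 0)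
    (h₂₃ : inner ℝ e₂ e₃ = 0) {κ : ℝ} (hκ : 0 ≤ κ) {ξ : Fin n → ℂ}
    (hξ : bdot (nullv e₁ e₂) ξ = ((-(2 * κ) : ℝ) : ℂ)) :
    ∫ x in Ω, contr (T x) (fun _ => nullv e₁ e₂)
      * (Complex.I * bdot (nullv e₁ e₂) ξ * (β x)⁻¹ + dirD (nullv e₁ e₂) (fun y => (β y)⁻¹) x)
      * ((β x)⁻¹ ^ 2 * expo ξ x) = 0 := by
  set z := nullv e₁ e₂ with hzdef
  have hz : IsNullDir z := isNullDir_nullv h₁ h₂ h₁₂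
  let ζ : ℕ → Fin n → ℂ := fun M => nullv
    ((((M : ℝ) + 1) - κ) • e₁ + (2 * Real.sqrt (((M : ℝ) + 1) * κ)) • e₃) ((((M : ℝ) + 1) + κ) • e₂)
  have hζ := fun M : ℕ => nullv_perturbed_null h₁ h₂ h₃ h₁₂ h₁₃ h₂₃ (s := (M : ℝ) + 1)
    (by positivity) hκ
  have hτ : Tendsto (fun M : ℕ => ((M : ℝ) + 1) + κ) atTop atTop :=
    tendsto_atTop_add_const_right _ _ (tendsto_atTop_add_const_right _ _ tendsto_natCast_atTop_atTop)
  obtain ⟨A, hA1, hA2, ⟨C, hC⟩, hA4⟩ := exists_cgo_seq hΩ hΩb hβ hβ0 hγ h₂ 0 (ζ := ζ) hτ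
    (fun M j => by simp [ζ, nullv]) (fun M => by simpa [bdot, pow_two] using (hζ M).1)
    (fun M => by simp)
  simp only [expo_zero, mul_one] at hA4
  have hρ : Continuous fun x => (β x)⁻¹ := (hβ.inv hβ0).continuous
  have hzero : ∀ M, ∫ x in Ω, contr (T x) (fun _ => z)
      * (Complex.I * bdot z ξ * A M x + dirD z (A M) x) * ((β x)⁻¹ ^ 2 * expo ξ x) = 0 := by
    intro M
    -- Since `z · ζ M = z · ξ` for all `M`, the amplitude `ξ - ζ M` is admissible, and it cancels
    -- the growing exponential of the third solution down to `exp (i ξ · x)`.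
    have hη : bdot z (ξ - ζ M) = 0 := by
      rw [bdot_sub_right, hξ, (hζ M).2, sub_self]
    rw [← integral_contr_mul_dirD_eq_zero hΩ hΩb hβ hβ0 hγ hTc hT hz hη (hA2 M)
      ((contDiff_expo _).mul (hA1 M))]
    refine integral_congr_ae (Eventually.of_forall fun x => ?_)
    beta_reduce
    have h1 : expo ξ x = expo (ζ M) x * expo (ξ - ζ M) x := by
      rw [← expo_add]; simp
    have h2 : bdot z (ζ M) = bdot z ξ := by rw [hξ]; exact (hζ M).2
    rw [dirD_mul z (contDiff_expo _) (hA1 M), dirD_expo, h1, h2]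
    ring
  obtain ⟨D, hD⟩ := hΩb.isCompact_closure.exists_bound_of_continuousOn
    (f := fun x => contr (T x) (fun _ => z)) (continuousOn_contr hTc _)
  obtain ⟨D', hD'⟩ := hΩb.isCompact_closure.exists_bound_of_continuousOn
    (f := fun x => (β x)⁻¹ ^ 2 * expo ξ x)
    ((hρ.pow 2).mul (contDiff_expo ξ).continuous).continuousOn
  have hlim : Tendsto (fun M => ∫ x in Ω, contr (T x) (fun _ => z)
      * (Complex.I * bdot z ξ * A M x + dirD z (A M) x) * ((β x)⁻¹ ^ 2 * expo ξ x)) atTop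
      (𝓝 (∫ x in Ω, contr (T x) (fun _ => z)
      * (Complex.I * bdot z ξ * (β x)⁻¹ + dirD z (fun y => (β y)⁻¹) x)
      * ((β x)⁻¹ ^ 2 * expo ξ x))) := by
    refine tendsto_integral_of_dominated_convergence
      (fun _ => D * (‖bdot z ξ‖ * C + ∑ i, ‖z i‖ * C) * D') (fun M => ?_) ?_ (fun M => ?_) ?_
    · refine ContinuousOn.aestronglyMeasurable ?_ hΩ.measurableSet
      exact (((continuousOn_contr hTc _).mono subset_closure).mul
        ((continuous_const.mul (hA1 M).continuous).add
          (continuous_dirD z (hA1 M))).continuousOn).mul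
        ((hρ.pow 2).mul (contDiff_expo ξ).continuous).continuousOn
    · exact integrableOn_const hΩb.measure_lt_top.ne
    · refine (ae_restrict_iff' hΩ.measurableSet).2 (Eventually.of_forall fun x hx => ?_)
      obtain ⟨hc1, hc2⟩ := hC M x hx
      have hC0 : 0 ≤ C := (norm_nonneg _).trans hc1
      have hD0 : 0 ≤ D := (norm_nonneg _).trans (hD x (subset_closure hx))
      have hs0 : 0 ≤ ∑ i, ‖z i‖ * C := Finset.sum_nonneg fun i _ => by positivity
      rw [norm_mul, norm_mul]
      refine mul_le_mul (mul_le_mul (hD x (subset_closure hx)) ?_ (norm_nonneg _) hD0)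
        (hD' x (subset_closure hx)) (norm_nonneg _) (by positivity)
      refine (norm_add_le _ _).trans (add_le_add ?_ ?_)
      · rw [norm_mul, norm_mul, Complex.norm_I, one_mul]
        gcongr
      · refine (norm_sum_le _ _).trans (Finset.sum_le_sum fun i _ => ?_)
        rw [norm_mul]
        gcongr
        exact hc2 i
    · refine (ae_restrict_iff' hΩ.measurableSet).2 (Eventually.of_forall fun x hx => ?_)
      obtain ⟨h1, h2⟩ := hA4 x hx
      exact (((h1.const_mul _).add (tendsto_finsetSum _ fun i _ => (h2 i).const_mul _)).const_mul
        _).mul_const _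
  simp_rw [hzero] at hlim
  exact tendsto_nhds_unique hlim tendsto_const_nhds

/-- The perturbed null vectors only reach nonpositive real values of `z · ξ`; multiplying `z` by
this phase arranges that sign. -/
lemma exists_unit_mul_eq_neg_norm (w : ℂ) :
    ∃ p q : ℝ, p ^ 2 + q ^ 2 = 1 ∧ ((p : ℂ) + q * Complex.I) * w = ((-‖w‖ : ℝ) : ℂ) := by
  by_cases hw : w = 0
  · exact ⟨1, 0, by norm_num, by simp [hw]⟩
  · have hn : ‖w‖ ≠ 0 := norm_ne_zero_iff.2 hw
    have hn2 : ‖w‖ ^ 2 = w.re ^ 2 + w.im ^ 2 := by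
      rw [← Complex.normSq_eq_norm_sq, Complex.normSq_apply]; ring
    refine ⟨-w.re / ‖w‖, w.im / ‖w‖, ?_, ?_⟩
    · field_simp
      linarith
    · apply Complex.ext
      · simp
        field_simp
        linarith
      · simp
        field_simp
        ring

/-- A phase times `e₁ + i e₂` is again the null vector of an orthonormal pair, obtained by rotating
in the plane. The integrand is homogeneous of degree two in the null vector, so the case of
nonpositive real `z · ξ` gives every `ξ`. -/
lemma integral_contr_mul_dirD_inv (hΩ : IsOpen Ω) (hΩb : Bornology.IsBounded Ω)
    (hβ : ContDiff ℝ ∞ β) (hβ0 : ∀ x, β x ≠ 0) (hγ : ∀ x ∈ closure Ω, (γ₀ x : ℂ) = β x ^ 2)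
    (hTc : ContinuousOn T (closure Ω))
    (hT : ∀ u : Fin 3 → EuclideanSpace ℝ (Fin n) → ℂ,
      (∀ l, IsSmoothSolution Ω γ₀ (u l)) →
      ∑ l : Equiv.Perm (Fin 2), ∑ j : Fin 1 → Fin n,
        ∫ x in Ω, T x j
          * (∏ k : Fin 1, partialD (j k) (u (l k.castSucc).castSucc) x)
          * gradDot (u (l (Fin.last 1)).castSucc) (u (Fin.last 2)) x = 0)
    {e₁ e₂ e₃ : EuclideanSpace ℝ (Fin n)} (h₁ : ‖e₁‖ = 1) (h₂ : ‖e₂‖ = 1)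
    (h₃ : ‖e₃‖ = 1) (h₁₂ : inner ℝ e₁ e₂ = 0) (h₁₃ : inner ℝ e₁ e₃ = 0)
    (h₂₃ : inner ℝ e₂ e₃ = 0) (ξ : Fin n → ℂ) :
    ∫ x in Ω, contr (T x) (fun _ => nullv e₁ e₂)
      * (Complex.I * bdot (nullv e₁ e₂) ξ * (β x)⁻¹ + dirD (nullv e₁ e₂) (fun y => (β y)⁻¹) x)
      * ((β x)⁻¹ ^ 2 * expo ξ x) = 0 := by
  obtain ⟨p, q, hpq, hw⟩ := exists_unit_mul_eq_neg_norm (bdot (nullv e₁ e₂) ξ)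
  set c : ℂ := (p : ℂ) + q * Complex.I with hc
  have hc0 : c ≠ 0 := by
    intro h
    have hp : p = 0 := by simpa [hc] using congrArg Complex.re h
    have hq : q = 0 := by simpa [hc] using congrArg Complex.im h
    simp [hp, hq] at hpq
  have s₁ : inner ℝ e₁ e₁ = (1 : ℝ) := by rw [real_inner_self_eq_norm_sq, h₁, one_pow]
  have s₂ : inner ℝ e₂ e₂ = (1 : ℝ) := by rw [real_inner_self_eq_norm_sq, h₂, one_pow]
  have h₂₁ : inner ℝ e₂ e₁ = 0 := by rw [real_inner_comm]; exact h₁₂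
  have hrot : nullv (p • e₁ - q • e₂) (q • e₁ + p • e₂) = c • nullv e₁ e₂ := by
    funext j
    simp [nullv, hc]
    linear_combination (-(q : ℂ) * (e₂ j : ℂ)) * Complex.I_sq
  have hn₁ : ‖p • e₁ - q • e₂‖ = 1 := by
    rw [← sq_eq_sq₀ (norm_nonneg _) zero_le_one, ← real_inner_self_eq_norm_sq]
    simp only [inner_sub_left, inner_sub_right, real_inner_smul_left, real_inner_smul_right, s₁, s₂,
      h₁₂, h₂₁]
    linarith
  have hn₂ : ‖q • e₁ + p • e₂‖ = 1 := by
    rw [← sq_eq_sq₀ (norm_nonneg _) zero_le_one, ← real_inner_self_eq_norm_sq]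
    simp only [inner_add_left, inner_add_right, real_inner_smul_left, real_inner_smul_right, s₁, s₂,
      h₁₂, h₂₁]
    linarith
  have key := integral_contr_mul_dirD_inv_aux hΩ hΩb hβ hβ0 hγ hTc hT hn₁ hn₂ h₃
    (by
      simp only [inner_sub_left, inner_add_right, real_inner_smul_left, real_inner_smul_right, s₁,
        s₂, h₁₂, h₂₁]
      ring)
    (by simp [inner_sub_left, real_inner_smul_left, h₁₃, h₂₃])
    (by simp [inner_add_left, real_inner_smul_left, h₁₃, h₂₃])
    (κ := ‖bdot (nullv e₁ e₂) ξ‖ / 2) (by positivity) (ξ := ξ)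
    (by rw [hrot, bdot_smul_left, hw]; congr 1; ring)
  rw [hrot] at key
  have h2 : ∀ x, contr (T x) (fun _ => c • nullv e₁ e₂)
      * (Complex.I * bdot (c • nullv e₁ e₂) ξ * (β x)⁻¹
        + dirD (c • nullv e₁ e₂) (fun y => (β y)⁻¹) x) * ((β x)⁻¹ ^ 2 * expo ξ x)
      = c ^ 2 * (contr (T x) (fun _ => nullv e₁ e₂)
      * (Complex.I * bdot (nullv e₁ e₂) ξ * (β x)⁻¹ + dirD (nullv e₁ e₂) (fun y => (β y)⁻¹) x)
      * ((β x)⁻¹ ^ 2 * expo ξ x)) := by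
    intro x
    rw [MultilinearMap.map_smul_univ, bdot_smul_left, dirD_smul]
    simp
    ring
  simp_rw [h2, integral_const_mul] at key
  exact (mul_eq_zero.1 key).resolve_left (pow_ne_zero _ hc0)

end

/-! ### Rank one: removing the factor `β⁻¹` and concluding. -/

section

variable {n : ℕ} {Ω : Set (EuclideanSpace ℝ (Fin n))} {γ₀ : EuclideanSpace ℝ (Fin n) → ℝ}
  {β : EuclideanSpace ℝ (Fin n) → ℂ} {T : EuclideanSpace ℝ (Fin n) → (Fin 1 → Fin n) → ℂ}

/-- A smooth function is the sum of an exponential series on a bounded open set. -/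
lemma exists_expSeries_eqOn (hΩb : Bornology.IsBounded Ω) (hβ : ContDiff ℝ ∞ β) :
    ∃ (μ : (Fin n → ℤ) → EuclideanSpace ℝ (Fin n)) (c : (Fin n → ℤ) → ℂ) (M : ℝ),
      (∀ k, ‖μ k‖ ≤ M * wt k) ∧ RapidDecay c ∧ Set.EqOn β (expSeries μ c) Ω := by
  obtain ⟨R, hR, hΩR⟩ : ∃ R > 0, ∀ x ∈ Ω, ‖x‖ ≤ R := hΩb.exists_pos_norm_le
  let χ : ContDiffBump (0 : EuclideanSpace ℝ (Fin n)) := ⟨R, 2 * R, hR, by linarith⟩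
  have hL : 0 < 8 * R := by positivity
  have hL4 : 8 * R / 4 = 2 * R := by ring
  obtain ⟨c, hc, hsum⟩ := exists_fourier_series hL (EuclideanSpace.basisFun (Fin n) ℝ)
    (f := fun x => β x * (χ x : ℂ)) (hβ.mul (Complex.ofRealCLM.contDiff.comp χ.contDiff))
    (fun x hx => by
      have : χ x = 0 := χ.zero_of_le_dist (by rw [dist_zero_right]; rw [hL4] at hx; exact hx.le)
      simp [this])
  refine ⟨lat (8 * R) (EuclideanSpace.basisFun (Fin n) ℝ), c, 2 * Real.pi / (8 * R) * n,
    fun k => (norm_lat_le hL k).trans ?_, hc, fun x hx => ?_⟩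
  · unfold wt
    gcongr
    linarith
  · have h1 : χ x = 1 := χ.one_of_mem_closedBall (by simpa using hΩR x hx)
    have := (hsum x (by rw [hL4]; linarith [hΩR x hx])).tsum_eq
    rw [h1, Complex.ofReal_one, mul_one] at this
    exact this.symm

lemma dirD_expSeries {μ : (Fin n → ℤ) → EuclideanSpace ℝ (Fin n)} {c : (Fin n → ℤ) → ℂ} {M : ℝ}
    (hM : ∀ k, ‖μ k‖ ≤ M * wt k) (hc : RapidDecay c) (z : Fin n → ℂ)
    (x : EuclideanSpace ℝ (Fin n)) :
    HasSum (fun k => Complex.I * bdot z (cvec (μ k)) * (c k * expo (cvec (μ k)) x))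
      (dirD z (expSeries μ c) x) := by
  have h1 : ∀ j, HasSum (fun k => z j * (Complex.I * (μ k j : ℂ) * c k * expo (cvec (μ k)) x))
      (z j * partialD j (expSeries μ c) x) := by
    intro j
    have hr := rapidDecay_mul hc (norm_freq_le hM 0 j)
    simp only [add_zero] at hr
    rw [partialD_expSeries hM hc]
    exact (summable_expSeries hr x).hasSum.mul_left _
  have h2 := hasSum_sum fun j (_ : j ∈ Finset.univ) => h1 j
  refine HasSum.congr_fun h2 fun k => ?_
  rw [bdot, Finset.mul_sum, Finset.sum_mul]
  refine Finset.sum_congr rfl fun j _ => ?_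
  rw [cvec_apply]
  ring

/-- The hypothesis reads `∫ f z · ∇(β⁻¹ g) = 0` for every real exponential `g`. Expanding `β` in
real exponentials on `Ω` extends it to `g = β exp (i ξ · x)`, where the derivative is just `i (z ·
ξ) exp (i ξ · x)`. -/
lemma integral_mul_expo_eq_zero (hΩ : IsOpen Ω) (hΩb : Bornology.IsBounded Ω)
    (hβ : ContDiff ℝ ∞ β) (hβ0 : ∀ x, β x ≠ 0) {f : EuclideanSpace ℝ (Fin n) → ℂ}
    (hf : ContinuousOn f (closure Ω)) (z : Fin n → ℂ)
    (h : ∀ ξ : EuclideanSpace ℝ (Fin n), ∫ x in Ω, f x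
      * (Complex.I * bdot z (cvec ξ) * (β x)⁻¹ + dirD z (fun y => (β y)⁻¹) x)
      * expo (cvec ξ) x = 0) {ξ : EuclideanSpace ℝ (Fin n)} (hξ : bdot z (cvec ξ) ≠ 0) :
    ∫ x in Ω, f x * expo (cvec ξ) x = 0 := by
  obtain ⟨μ, c, M, hM, hc, hβeq⟩ := exists_expSeries_eqOn hΩb hβ
  have hρ : ContDiff ℝ ∞ fun x => (β x)⁻¹ := hβ.inv hβ0
  have hM0 : 0 ≤ M := nonneg_of_mul_nonneg_left ((norm_nonneg _).trans (hM 0)) (wt_pos _)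
  let F : (Fin n → ℤ) → EuclideanSpace ℝ (Fin n) → ℂ := fun k x => c k * (f x
      * (Complex.I * bdot z (cvec (μ k + ξ)) * (β x)⁻¹ + dirD z (fun y => (β y)⁻¹) x)
      * expo (cvec (μ k + ξ)) x)
  have hFz : ∀ k, ∫ x in Ω, F k x = 0 := fun k => by
    simp only [F]
    rw [integral_const_mul, h, mul_zero]
  have hFint : ∀ k, IntegrableOn (F k) Ω := fun k =>
    integrableOn_of_continuousOn_closure hΩb <| continuousOn_const.mul <|
      (hf.mul ((continuous_const.mul hρ.continuous).add
        (continuous_dirD z hρ)).continuousOn).mul (contDiff_expo _).continuous.continuousOn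
  -- pointwise sum
  have hFsum : ∀ x ∈ Ω, HasSum (fun k => F k x)
      (Complex.I * bdot z (cvec ξ) * (f x * expo (cvec ξ) x)) := by
    intro x hx
    have h1 := dirD_expSeries hM hc z x
    have h2 : HasSum (fun k => c k * expo (cvec (μ k)) x) (β x) := by
      rw [hβeq hx]; exact (summable_expSeries hc x).hasSum
    have h3 : dirD z (expSeries μ c) x = dirD z β x := by
      unfold dirD
      refine Finset.sum_congr rfl fun i _ => ?_
      rw [partialD_congr (Filter.eventually_of_mem (hΩ.mem_nhds hx) fun y hy => (hβeq hy).symm)]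
    have h4 : dirD z β x * (β x)⁻¹ + β x * dirD z (fun y => (β y)⁻¹) x = 0 := by
      rw [← dirD_mul z hβ hρ]
      have : (fun y => β y * (β y)⁻¹) = fun _ => 1 := by
        funext y; exact mul_inv_cancel₀ (hβ0 y)
      rw [this]
      simp [dirD, partialD]
    rw [h3] at h1
    have h5 := ((h1.mul_right (f x * expo (cvec ξ) x * (β x)⁻¹)).add
      (h2.mul_right (f x * expo (cvec ξ) x
        * (Complex.I * bdot z (cvec ξ) * (β x)⁻¹ + dirD z (fun y => (β y)⁻¹) x))))
    have hval : Complex.I * bdot z (cvec ξ) * (f x * expo (cvec ξ) x)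
        = dirD z β x * (f x * expo (cvec ξ) x * (β x)⁻¹) + β x * (f x * expo (cvec ξ) x
          * (Complex.I * bdot z (cvec ξ) * (β x)⁻¹ + dirD z (fun y => (β y)⁻¹) x)) := by
      have := mul_inv_cancel₀ (hβ0 x)
      linear_combination (-(f x * expo (cvec ξ) x)) * h4
        - (f x * expo (cvec ξ) x * Complex.I * bdot z (cvec ξ)) * this
    rw [hval]
    refine HasSum.congr_fun h5 fun k => ?_
    simp only [F, cvec_add, expo_add, bdot_add_right]
    ring
  obtain ⟨D, hD⟩ := hΩb.isCompact_closure.exists_bound_of_continuousOn hf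
  obtain ⟨D₁, hD₁⟩ := hΩb.isCompact_closure.exists_bound_of_continuousOn
    (f := fun x => (β x)⁻¹) hρ.continuous.continuousOn
  obtain ⟨D₂, hD₂⟩ := hΩb.isCompact_closure.exists_bound_of_continuousOn
    (f := dirD z fun y => (β y)⁻¹) (continuous_dirD z hρ).continuousOn
  have hzb : ∀ v : EuclideanSpace ℝ (Fin n), ‖bdot z (cvec v)‖ ≤ (∑ i, ‖z i‖) * ‖v‖ := by
    intro v
    rw [Finset.sum_mul]
    refine (norm_sum_le _ _).trans (Finset.sum_le_sum fun i _ => ?_)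
    rw [norm_mul]
    gcongr
    exact norm_apply_le_norm v i
  set Z := ∑ i, ‖z i‖
  have hZ0 : 0 ≤ Z := Finset.sum_nonneg fun _ _ => norm_nonneg _
  have hFb : ∀ k, ∀ x ∈ Ω, ‖F k x‖
      ≤ |D| * (Z * (M + ‖ξ‖) * |D₁| + |D₂|) * (wt k ^ 1 * ‖c k‖) := by
    intro k x hx
    have hx' := subset_closure hx
    have hb1 : ‖bdot z (cvec (μ k + ξ))‖ ≤ Z * (M + ‖ξ‖) * wt k := by
      refine (hzb _).trans ?_
      rw [mul_assoc]
      gcongr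
      refine (norm_add_le _ _).trans ?_
      have := hM k
      nlinarith [one_le_wt k, norm_nonneg ξ]
    have hw := one_le_wt k
    simp only [F]
    rw [norm_mul, norm_mul, norm_mul, norm_expo_cvec, mul_one]
    have hb2 : ‖Complex.I * bdot z (cvec (μ k + ξ)) * (β x)⁻¹ + dirD z (fun y => (β y)⁻¹) x‖
        ≤ (Z * (M + ‖ξ‖) * |D₁| + |D₂|) * wt k := by
      refine (norm_add_le _ _).trans ?_
      rw [norm_mul, norm_mul, Complex.norm_I, one_mul, add_mul]
      refine add_le_add ?_ ?_
      · calc _ ≤ (Z * (M + ‖ξ‖) * wt k) * |D₁| :=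
            mul_le_mul hb1 ((hD₁ x hx').trans (le_abs_self _)) (norm_nonneg _) (by positivity)
          _ = _ := by ring
      · calc _ ≤ |D₂| := (hD₂ x hx').trans (le_abs_self _)
          _ ≤ |D₂| * wt k := le_mul_of_one_le_right (abs_nonneg _) hw
    calc _ ≤ ‖c k‖ * (|D| * ((Z * (M + ‖ξ‖) * |D₁| + |D₂|) * wt k)) := by
          gcongr
          exact (hD x hx').trans (le_abs_self _)
      _ = _ := by ring
  have hsn : Summable fun k => ∫ x in Ω, ‖F k x‖ := by
    refine Summable.of_nonneg_of_le (fun k => integral_nonneg fun x => norm_nonneg _) (fun k => ?_)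
      (((hc.summable 1).mul_left (|D| * (Z * (M + ‖ξ‖) * |D₁| + |D₂|))).mul_right
        (volume.real Ω))
    refine (setIntegral_mono_on (hFint k).norm (integrableOn_const hΩb.measure_lt_top.ne)
      hΩ.measurableSet (hFb k)).trans (le_of_eq ?_)
    rw [setIntegral_const, smul_eq_mul, mul_comm]
  have htot := hasSum_integral_of_summable_integral_norm (fun k => hFint k) hsn
  simp_rw [hFz] at htot
  have h0 : ∫ x in Ω, ∑' k, F k x = 0 := htot.unique hasSum_zero
  rw [setIntegral_congr_fun hΩ.measurableSet fun x hx => (hFsum x hx).tsum_eq,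
    integral_const_mul] at h0
  exact (mul_eq_zero.1 h0).resolve_left (mul_ne_zero Complex.I_ne_zero hξ)

/-- Vanishing of `T` for rank one. -/
lemma eq_zero_of_rank_one (hn : 3 ≤ n) (hΩ : IsOpen Ω) (hΩb : Bornology.IsBounded Ω)
    (hβ : ContDiff ℝ ∞ β) (hβ0 : ∀ x, β x ≠ 0) (hγ : ∀ x ∈ closure Ω, (γ₀ x : ℂ) = β x ^ 2)
    (hTc : ContinuousOn T (closure Ω)) (hTs : ∀ x ∈ closure Ω, IsSymmTensor (T x))
    (hT : ∀ u : Fin 3 → EuclideanSpace ℝ (Fin n) → ℂ,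
      (∀ l, IsSmoothSolution Ω γ₀ (u l)) →
      ∑ l : Equiv.Perm (Fin 2), ∑ j : Fin 1 → Fin n,
        ∫ x in Ω, T x j
          * (∏ k : Fin 1, partialD (j k) (u (l k.castSucc).castSucc) x)
          * gradDot (u (l (Fin.last 1)).castSucc) (u (Fin.last 2)) x = 0)
    {x : EuclideanSpace ℝ (Fin n)} (hx : x ∈ Ω) : T x = 0 := by
  have hρ : Continuous fun x => (β x)⁻¹ := (hβ.inv hβ0).continuous
  have hnull : ∀ {e₁ e₂ e₃ : EuclideanSpace ℝ (Fin n)}, ‖e₁‖ = 1 → ‖e₂‖ = 1 → ‖e₃‖ = 1 →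
      inner ℝ e₁ e₂ = 0 → inner ℝ e₁ e₃ = 0 → inner ℝ e₂ e₃ = 0 →
      contr (T x) (fun _ => nullv e₁ e₂) = 0 := by
    intro e₁ e₂ e₃ h₁ h₂ h₃ h₁₂ h₁₃ h₂₃
    let f : EuclideanSpace ℝ (Fin n) → ℂ := fun x =>
      contr (T x) (fun _ => nullv e₁ e₂) * (β x)⁻¹ ^ 2
    have hf : ContinuousOn f (closure Ω) :=
      (continuousOn_contr hTc _).mul (hρ.pow 2).continuousOn
    have hne : ∀ ξ : EuclideanSpace ℝ (Fin n), bdot (nullv e₁ e₂) (cvec ξ) ≠ 0 →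
        ∫ x in Ω, f x * expo (cvec ξ) x = 0 := by
      intro ξ hξ
      refine integral_mul_expo_eq_zero hΩ hΩb hβ hβ0 hf (nullv e₁ e₂) (fun ξ => ?_) hξ
      rw [← integral_contr_mul_dirD_inv hΩ hΩb hβ hβ0 hγ hTc hT h₁ h₂ h₃ h₁₂ h₁₃ h₂₃ (cvec ξ)]
      refine integral_congr_ae (Eventually.of_forall fun x => ?_)
      simp only [f]
      ring
    have hall : ∀ ξ : EuclideanSpace ℝ (Fin n), ∫ x in Ω, f x * expo (cvec ξ) x = 0 := by
      intro ξ
      by_cases hξ : bdot (nullv e₁ e₂) (cvec ξ) = 0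
      -- Frequencies with `z · ξ = 0` are limits of admissible ones: moving along `e₁` changes `z ·
      -- ξ` because `z · e₁ = 1`, and the integral is continuous in the frequency.
      · have h1 : ∀ k : ℕ, bdot (nullv e₁ e₂) (cvec (ξ + (1 / ((k : ℝ) + 1)) • e₁)) ≠ 0 := by
          intro k
          have h2 : bdot (nullv e₁ e₂) (cvec ((1 / ((k : ℝ) + 1)) • e₁))
              = ((1 / ((k : ℝ) + 1) : ℝ) : ℂ) := by
            rw [nullv, bdot_add_left, bdot_smul_left, bdot_cvec, bdot_cvec, real_inner_smul_right,
              real_inner_smul_right, real_inner_self_eq_norm_sq, h₁, real_inner_comm, h₁₂]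
            simp
          rw [cvec_add, bdot_add_right, hξ, h2, zero_add]
          exact_mod_cast (by positivity : (1 / ((k : ℝ) + 1)) ≠ 0)
        have h3 : Tendsto (fun k : ℕ => ∫ x in Ω, f x * expo (cvec (ξ + (1 / ((k : ℝ) + 1)) • e₁)) x)
            atTop (𝓝 (∫ x in Ω, f x * expo (cvec ξ) x)) := by
          refine tendsto_integral_of_dominated_convergence (fun x => ‖f x‖) (fun k => ?_)
            (integrableOn_of_continuousOn_closure hΩb hf).norm (fun k => ?_) ?_
          · exact ((hf.mono subset_closure).mul
              (contDiff_expo _).continuous.continuousOn).aestronglyMeasurable hΩ.measurableSet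
          · exact Eventually.of_forall fun y => by rw [norm_mul, norm_expo_cvec, mul_one]
          · refine Eventually.of_forall fun y => Tendsto.const_mul _ ?_
            have h4 : Tendsto (fun k : ℕ => ξ + (1 / ((k : ℝ) + 1)) • e₁) atTop (𝓝 ξ) := by
              simpa using (tendsto_one_div_add_atTop_nhds_zero_nat (𝕜 := ℝ)).smul_const e₁
                |>.const_add ξ
            have h5 : Continuous fun v : EuclideanSpace ℝ (Fin n) => expo (cvec v) y := by
              unfold expo
              simp_rw [dotL_cvec]
              fun_prop
            exact (h5.tendsto ξ).comp h4
        simp_rw [fun k => hne _ (h1 k)] at h3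
        exact tendsto_nhds_unique h3 tendsto_const_nhds
      · exact hne ξ hξ
    have := eq_zero_of_fourier_eq_zero hΩ hΩb hf hall x hx
    exact (mul_eq_zero.1 this).resolve_right (pow_ne_zero _ (inv_ne_zero (hβ0 x)))
  refine eq_zero_of_contr_unit_diag_eq_zero le_rfl (hTs x (subset_closure hx)) fun e₁ h₁ => ?_
  obtain ⟨e₂, e₃, h₂, h₃, h₁₂, h₁₃, h₂₃⟩ := exists_orthonormal_triple hn h₁
  have g1 := hnull h₁ h₂ h₃ h₁₂ h₁₃ h₂₃
  have g2 := hnull h₁ (e₂ := -e₂) (by simpa using h₂) h₃ (by simpa using h₁₂) h₁₃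
    (by simpa using h₂₃)
  simp only [contr_apply, Fin.prod_univ_one] at g1 g2 ⊢
  have h3 : (2 : ℂ) * ∑ j : Fin 1 → Fin n, T x j * cvec e₁ (j 0) = 0 := by
    rw [← add_zero (0 : ℂ)]
    nth_rewrite 1 [← g1]
    rw [← g2, ← Finset.sum_add_distrib, Finset.mul_sum]
    refine Finset.sum_congr rfl fun j _ => ?_
    simp [nullv]
    ring
  exact (mul_eq_zero.1 h3).resolve_left two_ne_zero

end

end QuasilinearCalderon

end

theorem proposition1p5 {n : ℕ} (hn : 3 ≤ n)
    (Ω : Set (EuclideanSpace ℝ (Fin n))) (hΩo : IsOpen Ω) (hΩb : Bornology.IsBounded Ω)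
    (hΩs : QuasilinearCalderon.HasSmoothBoundary Ω)
    (γ₀ : EuclideanSpace ℝ (Fin n) → ℝ)
    (hγ₀s : QuasilinearCalderon.SmoothOnClosure Ω γ₀) (hγ₀p : ∀ x ∈ closure Ω, 0 < γ₀ x)
    (m : ℕ) (hm : 1 ≤ m)
    (T : EuclideanSpace ℝ (Fin n) → (Fin m → Fin n) → ℂ)
    (hTc : ContinuousOn T (closure Ω))
    (hTs : ∀ x ∈ closure Ω, QuasilinearCalderon.IsSymmTensor (T x))
    (hT : ∀ u : Fin (m + 2) → EuclideanSpace ℝ (Fin n) → ℂ,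
      (∀ l, QuasilinearCalderon.IsSmoothSolution Ω γ₀ (u l)) →
      ∑ l : Equiv.Perm (Fin (m + 1)), ∑ j : Fin m → Fin n,
        ∫ x in Ω, T x j
          * (∏ k : Fin m, QuasilinearCalderon.partialD (j k) (u (l k.castSucc).castSucc) x)
          * QuasilinearCalderon.gradDot
              (u (l (Fin.last m)).castSucc) (u (Fin.last (m + 1))) x = 0) :
    ∀ x ∈ Ω, T x = 0 := by
  intro x hx
  obtain ⟨β, hβ, hβ0, hγ⟩ := QuasilinearCalderon.exists_smooth_sqrt hγ₀s hγ₀p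
  rcases hm.eq_or_lt with rfl | hm
  · exact QuasilinearCalderon.eq_zero_of_rank_one hn hΩo hΩb hβ hβ0 hγ hTc hTs hT hx
  · exact QuasilinearCalderon.eq_zero_of_two_le_rank hn hm hΩo hΩb hβ hβ0 hγ hTc hTs hT hx
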